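/- Let $N$ be a smooth manifold (Hausdorff, second countable, without boundary), and let $J^1N=T^*N\times\mathbb R$ be its 1-jet bundle, with points $(q,p,z)$ and contact form $\alpha=\alpha_{std}$ given locally by $\alpha_{std}=\sum_i p_i\,dq_i-dz$, where $q_i$ are local coordinates on $N$ and $p_i$ the conjugate coordinates on the cotangent fibres. Let $\delta>0$ and let $U_\delta\subseteq J^1N$ be a local Weinstein neighbourhood of the zero section of height $2\delta$, that is, an open subset of the form $$U_\delta=\{(q,p,z)\in J^1N \mid q\in V,\ p\in W_q,\ |z|<\delta_q\},$$ where $V\subseteq N$ is open, each $W_q\subseteq T_q^*N$ ($q\in V$) is a neighbourhood of $0$ that is star-shaped about $0$, and $q\mapsto\delta_q$ is a function $V\to(0,\infty)$ with $\delta_q\le\delta$ for all $q\in V$. Equip $U_\delta$ with the restriction of $\alpha$. A compactly supported contact isotopy of $U_\delta$ is a family of diffeomorphisms $\phi_t:U_\delta\to U_\delta$, $t\in[0,1]$, smooth in $(t,x)$, with $\phi_0=\mathrm{id}$, such that every $\phi_t$ preserves $\ker\alpha$ and all $\phi_t$ are the identity outside a common compact subset of $U_\delta$. Its energy is $\|\phi_t\|_\alpha=\int_0^1\max_{x\in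 U_\delta}|\alpha(\dot\phi_t(x))|\,dt$. The energy $\|\phi\|_\alpha$ of the time-1 map $\phi$ of such an isotopy is the infimum of $\|\psi_t\|_\alpha$ over all compactly supported contact isotopies $\psi_t$ of $U_\delta$ with $\psi_1=\phi$. Then every compactly supported contact isotopy $\phi_t:U_\delta\to U_\delta$, $t\in[0,1]$, satisfies $\|\phi_1\|_\alpha<2\delta$. -/

import Mathlib

open Set Topology
open scoped Manifold ContDiff ENNReal

noncomputable section

/-! ## Contact isotopies and their energy -/

section Contact

variable {E : Type*} [NormedAddCommGroup E] [NormedSpace ℝ E]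
  {H : Type*} [TopologicalSpace H] (I : ModelWithCorners ℝ E H)
  {M : Type*} [TopologicalSpace M] [ChartedSpace H M]

/-- A 1-form on `M`, as a field of continuous linear functionals on the tangent spaces. -/
abbrev OneForm (M : Type*) [TopologicalSpace M] [ChartedSpace H M] :=
  ∀ x : M, TangentSpace I x →L[ℝ] ℝ

variable {I}

/-- The restriction of a 1-form to an open submanifold: its pullback under the inclusion. -/
def OneForm.restrict (α : OneForm I M) (U : TopologicalSpace.Opens M) : OneForm I U :=
  fun x => (α (x : M)).comp (mfderiv I I (Subtype.val : U → M) x)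

/-- `f` is a contactomorphism: a diffeomorphism of `M` that preserves the hyperplane field
`ker α`, that is, `df (ker α) = ker α`. -/
def IsContactomorphism (α : OneForm I M) (f : M → M) : Prop :=
  (∃ F : M ≃ₘ^∞⟮I, I⟯ M, ⇑F = f) ∧
    ∀ (x : M) (v : TangentSpace I x), α (f x) (mfderiv I I f x v) = 0 ↔ α x v = 0

/-- `φ t`, `t ∈ [0,1]`, is a compactly supported contact isotopy of `(M, α)` starting at the
identity, smooth jointly in time and space. Values at times outside `[0,1]` play no role. -/
structure IsContactIsotopy (α : OneForm I M) (φ : ℝ → M → M) : Prop where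
  zero : φ 0 = id
  smooth : ContMDiffOn (𝓘(ℝ, ℝ).prod I) I ∞ (fun y : ℝ × M => φ y.1 y.2) (Icc 0 1 ×ˢ univ)
  contact : ∀ t ∈ Icc (0 : ℝ) 1, IsContactomorphism α (φ t)
  compactSupport : ∃ K : Set M, IsCompact K ∧ ∀ t ∈ Icc (0 : ℝ) 1, ∀ x ∉ K, φ t x = x

/-- The time derivative of the path `s ↦ φ s x`, `s ∈ [0,1]`, at time `t`. -/
def isotopyVelocity (I : ModelWithCorners ℝ E H) (φ : ℝ → M → M) (t : ℝ) (x : M) :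
    TangentSpace I (φ t x) :=
  mfderivWithin 𝓘(ℝ, ℝ) I (fun s : ℝ => φ s x) (Icc 0 1) t (1 : ℝ)

/-- The contact Hamiltonian of the isotopy `φ` at time `t`, at the point `φ t x`:
`α` evaluated on the time derivative of `φ t x`. -/
def contactHamiltonian (α : OneForm I M) (φ : ℝ → M → M) (t : ℝ) (x : M) : ℝ :=
  α (φ t x) (isotopyVelocity I φ t x)

/-- The energy of an isotopy: the integral over `[0,1]` of the maximum norm of its contact
Hamiltonian. As `φ t` is a bijection, the supremum over all points `φ t x` is the supremum over
all points of `M`. -/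
def isotopyEnergy (α : OneForm I M) (φ : ℝ → M → M) : ℝ≥0∞ :=
  ∫⁻ t in Icc (0 : ℝ) 1, ⨆ x : M, ENNReal.ofReal |contactHamiltonian α φ t x|

/-- The energy of a contactomorphism `f` of `(M, α)`: the infimum of the energies of the compactly
supported contact isotopies of `(M, α)` with time-1 map `f`. -/
def contactEnergy (α : OneForm I M) (f : M → M) : ℝ≥0∞ :=
  ⨅ (ψ : ℝ → M → M) (_ : IsContactIsotopy α ψ) (_ : ψ 1 = f), isotopyEnergy α ψ

end Contact

/-! ## The 1-jet bundle and its standard contact form -/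

section Jet

/-- The cotangent space `T*_q N` of a manifold modelled on `ℝⁿ`. -/
abbrev CotangentSpace (n : ℕ) {N : Type*} [TopologicalSpace N]
    [ChartedSpace (EuclideanSpace ℝ (Fin n)) N] (q : N) : Type :=
  TangentSpace (𝓡 n) q →L[ℝ] ℝ

/-- The cotangent bundle `T*N`; its topology and smooth structure are Mathlib's ones on the total
space of a bundle of continuous linear maps. -/
abbrev CotangentBundle (n : ℕ) (N : Type*) [TopologicalSpace N]
    [ChartedSpace (EuclideanSpace ℝ (Fin n)) N] :=
  Bundle.TotalSpace (EuclideanSpace ℝ (Fin n) →L[ℝ] ℝ) (fun q : N => CotangentSpace n q)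

/-- The 1-jet bundle `J¹N = T*N × ℝ`, with points `x = (q, p, z)`, where `q = x.1.proj`,
`p = x.1.snd` and `z = x.2`. -/
abbrev JetBundle (n : ℕ) (N : Type*) [TopologicalSpace N]
    [ChartedSpace (EuclideanSpace ℝ (Fin n)) N] :=
  CotangentBundle n N × ℝ

/-- The model with corners of `J¹N`, which is modelled on `ℝⁿ × (ℝⁿ)* × ℝ`. -/
abbrev jetModel (n : ℕ) :=
  ((𝓡 n).prod 𝓘(ℝ, EuclideanSpace ℝ (Fin n) →L[ℝ] ℝ)).prod 𝓘(ℝ, ℝ)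

variable {n : ℕ} {N : Type*} [TopologicalSpace N] [ChartedSpace (EuclideanSpace ℝ (Fin n)) N]
  [IsManifold (𝓡 n) ∞ N]

/-- The standard contact form `α_std = ∑ pᵢ dqᵢ - dz` on `J¹N`, written without coordinates: the
pullback of the tautological 1-form of `T*N`, which sends a tangent vector `v` at `(q, p)` to
`p (dπ v)` with `π : T*N → N` the projection, minus `dz`. -/
def stdContactForm (n : ℕ) (N : Type*) [TopologicalSpace N]
    [ChartedSpace (EuclideanSpace ℝ (Fin n)) N] [IsManifold (𝓡 n) ∞ N] :
    OneForm (jetModel n) (JetBundle n N) :=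
  fun x =>
    (x.1.snd : TangentSpace (𝓡 n) x.1.proj →L[ℝ] ℝ).comp
        (mfderiv (jetModel n) (𝓡 n) (fun y : JetBundle n N => y.1.proj) x)
      - mvfderiv (jetModel n) (fun y : JetBundle n N => y.2) x

/-- The open set `U` of `J¹N` is a local Weinstein neighbourhood of the zero section of height
`2 * δ`: it consists of the points `(q, p, z)` with `q ∈ V`, `p ∈ W q` and `|z| < d q`, where `V` is
open in `N`, each `W q` is a neighbourhood of `0` in `T*_q N` star-shaped about `0`, and
`d : V → (0, ∞)` is bounded above by `δ`. -/
def IsLocalWeinsteinNeighborhood (δ : ℝ) (U : TopologicalSpace.Opens (JetBundle n N)) : Prop :=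
  ∃ (V : Set N) (W : ∀ q : N, Set (CotangentSpace n q)) (d : N → ℝ),
    IsOpen V ∧ (∀ q ∈ V, W q ∈ 𝓝 (0 : CotangentSpace n q) ∧ StarConvex ℝ 0 (W q)) ∧
    (∀ q ∈ V, 0 < d q ∧ d q ≤ δ) ∧
    (U : Set (JetBundle n N)) = {x | x.1.proj ∈ V ∧ x.1.snd ∈ W x.1.proj ∧ |x.2| < d x.1.proj}

end Jet

end

/-! The rescaling s_l(q,p,z) = (q, l p, l z) pulls α back to l α, and for 0 < l ≤ 1 it maps U into
itself because the fibres of U are star-shaped. Conjugation by s_l therefore keeps supports in U and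
multiplies energy by l (`IsReachable.jetScale_conj`). Let g be the time-1 map, extended by the
identity, supported in a compact K ⊆ U and reached with energy B. If f is reached inside U and
agrees with s_l on K, then g = f⁻¹ (s_l g s_l⁻¹) f (`eq_inverse_comp_jetScale_conj`), so the energy
of g is at most twice that of f plus l B. It remains to find, for arbitrarily small l, such an f
whose energy stays below a constant less than δ that does not depend on l.

Heuristically f is the flow of a cut-off of the Hamiltonian z, whose uncut flow is s_{e^{-t}}: the
Hamiltonian has size e^{-t}|z| along orbits, and its integral over all t ≥ 0 is at most max |z| < δ.
The proof replaces the flow by a short step. There is a contact family ψ in U with ψ_t = s_{e^{-t}}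
on K for small t, and with Hamiltonian at most some D < δ near t = 0 (`exists_isSqueeze`,
`IsSqueeze.eventually_eq_jetScale`, `IsContactFamily.exists_hamiltonian_bound`). The step ψ_σ costs
σD; its conjugate by s_{e^{-kσ}} costs e^{-kσ}σD and continues the squeezing of K. The geometric sum
of these costs is at most (1 + σ)D, which is below δ for small σ (`IsReachable.exists_jetScale_pow`,
`mul_geom_sum_exp_neg_le`).

The family ψ is built without integrating a vector field. A function h(q,P,z) with small derivatives
generates the contact map sending (q, (1 - h_z)⁻¹(P + h_q), z) to (q + h_P, P, z + P h_P - h)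
(`exists_modelIsotopy`). In a chart, h = z (1 - e^{-tχ(q)}) β with a cut-off β fixes q and
multiplies z by e^{-tχ(q)} wherever β = 1. Composition over a partition of unity adds the exponents
up to -t near K, and preservation of the contact planes then forces p to be multiplied by e^{-t} as
well (`IsContactomorphism.eq_jetScale`). -/

noncomputable section

/-! ## Smooth families of perturbations of the identity -/

section Perturbation

variable {X : Type*} [NormedAddCommGroup X] [NormedSpace ℝ X] [FiniteDimensional ℝ X]

/-- A smooth family of `1/2`-contractive perturbations of the identity has a smooth family of
inverses. -/
theorem exists_contDiff_inverse_of_fderiv_le {a : ℝ → X → X}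
    (ha : ContDiff ℝ ∞ (Function.uncurry a)) (hd : ∀ t x, ‖fderiv ℝ (a t) x‖ ≤ 1 / 2) :
    ∃ G : ℝ → X → X, ContDiff ℝ ∞ (Function.uncurry G) ∧
      (∀ t x, G t (x + a t x) = x) ∧ ∀ t y, G t y + a t (G t y) = y := by
  have : CompleteSpace X := FiniteDimensional.complete ℝ X
  have hat : ∀ t, ContDiff ℝ ∞ (a t) := fun t => ha.comp (contDiff_const.prodMk contDiff_id)
  have hlip : ∀ t, LipschitzWith (1 / 2) (a t) := fun t =>
    lipschitzWith_of_nnnorm_fderiv_le ((hat t).differentiable (by simp)) fun x => by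
      rw [← NNReal.coe_le_coe]; simpa using hd t x
  have hc : ∀ t y, ContractingWith (1 / 2) (fun x => y - a t x) := fun t y =>
    ⟨by rw [← NNReal.coe_lt_coe]; norm_num, LipschitzWith.of_dist_le_mul fun u v => by
      rw [dist_sub_left]; exact (hlip t).dist_le_mul u v⟩
  -- The equation `x + a t x = y` says that `x` is the fixed point of the contraction `x ↦ y - a t
  -- x`.
  let G : ℝ → X → X := fun t y => ContractingWith.fixedPoint _ (hc t y)
  have hG : ∀ t y, G t y + a t (G t y) = y := fun t y => by
    have h : y - a t (G t y) = G t y := (hc t y).fixedPoint_isFixedPt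
    nth_rewrite 1 [← h]; abel
  have hGl : ∀ t x, G t (x + a t x) = x := fun t x => by
    symm
    apply (hc t (x + a t x)).fixedPoint_unique
    change x + a t x - a t x = x
    abel
  refine ⟨G, ?_, hGl, hG⟩
  -- Joint smoothness of `G` comes from the inverse function theorem for `Φ`, whose inverse is `(t,
  -- y) ↦ (t, G t y)`.
  let Φ : ℝ × X → ℝ × X := fun p => (p.1, p.2 + a p.1 p.2)
  have hΦ : ContDiff ℝ ∞ Φ := contDiff_fst.prodMk (contDiff_snd.add ha)
  have hΦinj : Function.Injective Φ := by
    rintro ⟨t, x⟩ ⟨t', x'⟩ h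
    obtain ⟨h1, h2⟩ := Prod.mk.inj h
    simp only at h1 h2
    subst h1
    rw [← hGl t x, h2, hGl]
  rw [contDiff_iff_contDiffAt]
  rintro ⟨t, y⟩
  set p : ℝ × X := (t, G t y) with hp
  have hΦp : Φ p = (t, y) := by simp [Φ, p, hG]
  have hder : HasFDerivAt Φ (fderiv ℝ Φ p) p := ((hΦ.differentiable (by simp)) p).hasFDerivAt
  have hda : HasFDerivAt (Function.uncurry a) (fderiv ℝ (Function.uncurry a) p) p :=
    ((ha.differentiable (by simp)) p).hasFDerivAt
  have hform : fderiv ℝ Φ p = (ContinuousLinearMap.fst ℝ ℝ X).prod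
      (ContinuousLinearMap.snd ℝ ℝ X + fderiv ℝ (Function.uncurry a) p) :=
    HasFDerivAt.fderiv (hasFDerivAt_fst.prodMk (hasFDerivAt_snd.add hda))
  have hpart : ∀ v, fderiv ℝ (Function.uncurry a) p (0, v) = fderiv ℝ (a t) (G t y) v := fun v => by
    have h1 : HasFDerivAt (fun x : X => ((t, x) : ℝ × X)) (ContinuousLinearMap.inr ℝ ℝ X) (G t y) :=
      hasFDerivAt_prodMk_right t (G t y)
    have h2 : HasFDerivAt (a t) _ (G t y) := hda.comp (G t y) h1
    rw [h2.fderiv]; simp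
  -- A kernel vector has no time component, and its space component `v` is minus its own image under
  -- the derivative of `a t`, so `‖v‖ ≤ ‖v‖ / 2`.
  have hinj : Function.Injective (fderiv ℝ Φ p) := by
    rw [injective_iff_map_eq_zero]
    rintro ⟨τ, v⟩ h
    rw [hform] at h
    simp only [ContinuousLinearMap.prod_apply, Prod.mk_eq_zero, ContinuousLinearMap.coe_fst',
      add_apply, ContinuousLinearMap.coe_snd'] at h
    obtain ⟨h1, h2⟩ := h
    subst h1
    rw [hpart] at h2
    have h3 : ‖v‖ ≤ 1 / 2 * ‖v‖ := by
      calc ‖v‖ = ‖fderiv ℝ (a t) (G t y) v‖ := by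
            rw [← norm_neg v, ← eq_neg_of_add_eq_zero_right h2]
        _ ≤ _ := ContinuousLinearMap.le_of_opNorm_le _ (hd _ _) v
    have : ‖v‖ = 0 := by linarith [norm_nonneg v]
    simp [norm_eq_zero.1 this]
  let e : (ℝ × X) ≃L[ℝ] (ℝ × X) :=
    (LinearEquiv.ofInjectiveEndo (fderiv ℝ Φ p : (ℝ × X) →ₗ[ℝ] (ℝ × X)) hinj).toContinuousLinearEquiv
  have he : (e : (ℝ × X) →L[ℝ] (ℝ × X)) = fderiv ℝ Φ p := by ext v <;> rfl
  rw [← he] at hder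
  have hn : (∞ : ℕ∞ω) ≠ 0 := by simp
  have hloc := hΦ.contDiffAt.to_localInverse hder hn
  rw [hΦp] at hloc
  have hstrict : HasStrictFDerivAt Φ (e : (ℝ × X) →L[ℝ] (ℝ × X)) p :=
    hΦ.contDiffAt.hasStrictFDerivAt' hder hn
  have hev := hstrict.eventually_right_inverse
  rw [hΦp] at hev
  have hloc2 : ContDiffAt ℝ ∞ (fun w : ℝ × X => (w.1, G w.1 w.2)) (t, y) := by
    refine hloc.congr_of_eventuallyEq ?_
    filter_upwards [hev] with w hw
    apply hΦinj
    refine Eq.trans ?_ hw.symm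
    simp [Φ, hG]
  exact contDiffAt_snd.comp (t, y) hloc2

/-- Tube lemma around `{0} × C`; off `C` there is nothing to bound. -/
theorem eventually_forall_norm_le_of_compactSupport {Y Z : Type*} [TopologicalSpace Y]
    [NormedAddCommGroup Z] {b : ℝ → Y → Z} (hb : Continuous (Function.uncurry b))
    (h0 : ∀ x, b 0 x = 0) {C : Set Y} (hC : IsCompact C) (hsupp : ∀ t, ∀ x ∉ C, b t x = 0)
    {ε : ℝ} (hε : 0 < ε) : ∀ᶠ t in 𝓝 (0 : ℝ), ∀ x, ‖b t x‖ ≤ ε := by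
  have h : ∀ x ∈ C, ∀ᶠ p : ℝ × Y in 𝓝 (0, x), ‖b p.1 p.2‖ < ε := fun x _ => by
    have hcont : Continuous fun p : ℝ × Y => ‖b p.1 p.2‖ := hb.norm
    exact hcont.continuousAt.eventually_lt continuousAt_const (by simpa [h0] using hε)
  filter_upwards [hC.eventually_forall_of_forall_eventually (P := fun t x => ‖b t x‖ < ε) h] with t ht x
  by_cases hx : x ∈ C
  · exact (ht x hx).le
  · simp [hsupp t x hx, hε.le]

/-- Precomposing a family with `s` keeps its germ at time `0` but only uses its values at small
times, so that estimates valid near time `0` hold for every real time. -/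
theorem exists_contDiff_eventuallyEq_id_abs_le {τ : ℝ} (hτ : 0 < τ) :
    ∃ s : ℝ → ℝ, ContDiff ℝ ∞ s ∧ (∀ᶠ t in 𝓝 0, s t = t) ∧ ∀ t, |s t| ≤ τ := by
  let f : ContDiffBump (0 : ℝ) := ⟨τ / 2, τ, by positivity, by linarith⟩
  refine ⟨fun t => t * f t, contDiff_id.mul f.contDiff, ?_, fun t => ?_⟩
  · filter_upwards [f.eventuallyEq_one] with t ht
    simp [ht]
  · change |t * f t| ≤ τ
    by_cases ht : |t| < τ
    · rw [abs_mul, abs_of_nonneg f.nonneg]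
      exact (mul_le_of_le_one_right (abs_nonneg t) f.le_one).trans ht.le
    · simp [f.zero_of_le_dist (x := t) (by simpa [f] using ht), hτ.le]

end Perturbation

/-! ## Contactomorphisms of the model space from generating functions -/

section Generating

variable (E : Type*) [NormedAddCommGroup E] [NormedSpace ℝ E]

/-- The model `E × E* × ℝ` of the 1-jet bundle. -/
abbrev ModelJet := (E × (E →L[ℝ] ℝ)) × ℝ

variable {E}

/-- The contact form `p dq - dz` of the model. -/
def modelForm (x v : ModelJet E) : ℝ := x.1.2 v.1.1 - v.2

variable [FiniteDimensional ℝ E]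

variable (E) in
/-- The identification of the bidual of a finite-dimensional space with the space. -/
def ofBidual : ((E →L[ℝ] ℝ) →L[ℝ] ℝ) →L[ℝ] E :=
  ∑ i, (ContinuousLinearMap.apply ℝ ℝ (LinearMap.toContinuousLinearMap
    ((Module.finBasis ℝ E).coord i))).smulRight (Module.finBasis ℝ E i)

/-- Expand `l` in the dual basis. The identification turns ∂h/∂p, a functional on covectors, into a
displacement of `q`. -/
theorem apply_ofBidual (L : (E →L[ℝ] ℝ) →L[ℝ] ℝ) (l : E →L[ℝ] ℝ) :
    l (ofBidual E L) = L l := by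
  have hl : l = ∑ i, l (Module.finBasis ℝ E i) •
      LinearMap.toContinuousLinearMap ((Module.finBasis ℝ E).coord i) := by
    ext v
    conv_lhs => rw [← (Module.finBasis ℝ E).sum_repr v, map_sum]
    simp [mul_comm]
  conv_rhs => rw [hl]
  simp [ofBidual, mul_comm (L _)]

/-- The partial derivative `∂h/∂q`. -/
def partialQ (h : ModelJet E → ℝ) (x : ModelJet E) : E →L[ℝ] ℝ :=
  (fderiv ℝ h x).comp ((ContinuousLinearMap.inl ℝ _ ℝ).comp (ContinuousLinearMap.inl ℝ E _))

/-- The partial derivative `∂h/∂p`, as a vector. -/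
def partialP (h : ModelJet E → ℝ) (x : ModelJet E) : E :=
  ofBidual E
    ((fderiv ℝ h x).comp ((ContinuousLinearMap.inl ℝ _ ℝ).comp (ContinuousLinearMap.inr ℝ E _)))

/-- The partial derivative `∂h/∂z`. -/
def partialZ (h : ModelJet E → ℝ) (x : ModelJet E) : ℝ := fderiv ℝ h x (0, 1)

theorem fderiv_eq_partials (h : ModelJet E → ℝ) (x v : ModelJet E) :
    fderiv ℝ h x v = partialQ h x v.1.1 + v.1.2 (partialP h x) + partialZ h x * v.2 := by
  have hv : v = ((v.1.1, 0), 0) + ((0, v.1.2), 0) + v.2 • ((0, 1) : ModelJet E) := by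
    ext <;> simp
  conv_lhs => rw [hv]
  rw [map_add, map_add, map_smul, partialP, apply_ofBidual, partialZ, smul_eq_mul, mul_comm]
  rfl

section Smooth

variable {h : ℝ → ModelJet E → ℝ} (hh : ContDiff ℝ ∞ (Function.uncurry h))
include hh

omit [FiniteDimensional ℝ E] in
theorem contDiff_fderiv_slice :
    ContDiff ℝ ∞ (fun p : ℝ × ModelJet E => fderiv ℝ (h p.1) p.2) := by
  refine ContDiff.fderiv (f := fun p : ℝ × ModelJet E => h p.1) (n := ∞) ?_ contDiff_snd le_rfl
  exact hh.comp ((contDiff_fst.comp contDiff_fst).prodMk contDiff_snd)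

omit [FiniteDimensional ℝ E] in
theorem contDiff_partialQ :
    ContDiff ℝ ∞ (fun p : ℝ × ModelJet E => partialQ (h p.1) p.2) :=
  (contDiff_fderiv_slice hh).clm_comp contDiff_const

theorem contDiff_partialP :
    ContDiff ℝ ∞ (fun p : ℝ × ModelJet E => partialP (h p.1) p.2) :=
  (ContinuousLinearMap.contDiff _).comp ((contDiff_fderiv_slice hh).clm_comp contDiff_const)

omit [FiniteDimensional ℝ E] in
theorem contDiff_partialZ :
    ContDiff ℝ ∞ (fun p : ℝ × ModelJet E => partialZ (h p.1) p.2) :=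
  (contDiff_fderiv_slice hh).clm_apply contDiff_const

end Smooth

/-- The displacement of the source map `(q, P, z) ↦ (q, (1 - h_z)⁻¹ (P + h_q), z)` of the
contactomorphism with generating function `h`. -/
def sourceShift (h : ModelJet E → ℝ) (x : ModelJet E) : ModelJet E :=
  ((0, (1 - partialZ h x)⁻¹ • (x.1.2 + partialQ h x) - x.1.2), 0)

/-- The displacement of the target map `(q, P, z) ↦ (q + h_P, P, z + P h_P - h)` of the
contactomorphism with generating function `h`. -/
def targetShift (h : ModelJet E → ℝ) (x : ModelJet E) : ModelJet E :=
  ((partialP h x, 0), x.1.2 (partialP h x) - h x)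

theorem shifts_eq_zero_of_eventuallyEq {h : ModelJet E → ℝ} {x : ModelJet E} (hx : h =ᶠ[𝓝 x] 0) :
    sourceShift h x = 0 ∧ targetShift h x = 0 ∧ partialZ h x = 0 := by
  have h1 : fderiv ℝ h x = 0 := by rw [hx.fderiv_eq]; simp
  have h2 : h x = 0 := hx.eq_of_nhds
  simp [sourceShift, targetShift, partialZ, partialQ, partialP, h1, h2]

omit [FiniteDimensional ℝ E] in
theorem contDiff_sourceShift {h : ℝ → ModelJet E → ℝ} (hh : ContDiff ℝ ∞ (Function.uncurry h))
    (hz : ∀ t x, |partialZ (h t) x| ≤ 1 / 2) :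
    ContDiff ℝ ∞ (Function.uncurry fun t => sourceShift (h t)) := by
  have hne : ∀ p : ℝ × ModelJet E, 1 - partialZ (h p.1) p.2 ≠ 0 := fun p => by
    have := le_abs_self (partialZ (h p.1) p.2)
    linarith [hz p.1 p.2]
  have hP : ContDiff ℝ ∞ fun p : ℝ × ModelJet E => p.2.1.2 :=
    contDiff_snd.comp (contDiff_fst.comp contDiff_snd)
  exact (contDiff_const.prodMk ((((contDiff_const.sub (contDiff_partialZ hh)).inv hne).smul
    (hP.add (contDiff_partialQ hh))).sub hP)).prodMk contDiff_const

theorem contDiff_targetShift {h : ℝ → ModelJet E → ℝ} (hh : ContDiff ℝ ∞ (Function.uncurry h)) :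
    ContDiff ℝ ∞ (Function.uncurry fun t => targetShift (h t)) := by
  have hP : ContDiff ℝ ∞ fun p : ℝ × ModelJet E => p.2.1.2 :=
    contDiff_snd.comp (contDiff_fst.comp contDiff_snd)
  exact ((contDiff_partialP hh).prodMk contDiff_const).prodMk
    ((hP.clm_apply (contDiff_partialP hh)).sub hh)

/-- Slowing down time makes the source and target maps of a compactly supported family of
generating functions uniformly close to the identity. -/
theorem exists_slowdown {h : ℝ → ModelJet E → ℝ} (hh : ContDiff ℝ ∞ (Function.uncurry h))
    (h0 : ∀ x, h 0 x = 0) {C : Set (ModelJet E)} (hC : IsCompact C)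
    (hsupp : ∀ t, ∀ x ∉ C, h t x = 0) :
    ∃ s : ℝ → ℝ, ContDiff ℝ ∞ s ∧ (∀ᶠ t in 𝓝 0, s t = t) ∧
      (∀ t x, |partialZ (h (s t)) x| ≤ 1 / 2) ∧
      (∀ t x, ‖fderiv ℝ (sourceShift (h (s t))) x‖ ≤ 1 / 2) ∧
      ∀ t x, ‖fderiv ℝ (targetShift (h (s t))) x‖ ≤ 1 / 2 := by
  have hz0 : h 0 = 0 := funext h0
  have hev : ∀ t, ∀ x ∉ C, h t =ᶠ[𝓝 x] 0 := fun t x hx => by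
    filter_upwards [hC.isClosed.isOpen_compl.mem_nhds hx] with y hy using hsupp t y hy
  have hslow : ∀ {P : ℝ → Prop}, (∀ᶠ t in 𝓝 0, P t) →
      ∃ s : ℝ → ℝ, ContDiff ℝ ∞ s ∧ (∀ᶠ t in 𝓝 0, s t = t) ∧ ∀ t, P (s t) := fun {P} hP => by
    obtain ⟨τ, hτ, hball⟩ := Metric.eventually_nhds_iff.1 hP
    obtain ⟨s, hs, hs0, hsτ⟩ := exists_contDiff_eventuallyEq_id_abs_le (half_pos hτ)
    exact ⟨s, hs, hs0, fun t => hball (by simpa using (hsτ t).trans_lt (half_lt_self hτ))⟩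
  -- A first slowdown keeps `1 - h_z` away from `0`, which smoothness of the source shift requires;
  -- only then can a second one make the derivatives of both shifts small.
  obtain ⟨s₁, hs₁, hs₁0, hb₁⟩ := hslow (eventually_forall_norm_le_of_compactSupport
    (b := fun t x => partialZ (h t) x) (contDiff_partialZ hh).continuous
    (fun x => (shifts_eq_zero_of_eventuallyEq (by rw [hz0])).2.2) hC
    (fun t x hx => (shifts_eq_zero_of_eventuallyEq (hev t x hx)).2.2) (ε := 1 / 2) (by norm_num))
  have hh₁ : ContDiff ℝ ∞ (Function.uncurry fun t => h (s₁ t)) :=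
    hh.comp ((hs₁.comp contDiff_fst).prodMk contDiff_snd)
  have hs₁z : s₁ 0 = 0 := hs₁0.self_of_nhds
  have key : ∀ {b : (ModelJet E → ℝ) → ModelJet E → ModelJet E},
      ContDiff ℝ ∞ (Function.uncurry fun t => b (h (s₁ t))) →
      (∀ f x, f =ᶠ[𝓝 x] 0 → b f x = 0) →
      ∀ᶠ t in 𝓝 0, ∀ x, ‖fderiv ℝ (b (h (s₁ t))) x‖ ≤ 1 / 2 := fun {b} hb hb0 => by
    refine eventually_forall_norm_le_of_compactSupport
      (b := fun t x => fderiv ℝ (b (h (s₁ t))) x) ?_ (fun x => ?_) hC (fun t x hx => ?_)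
      (by norm_num)
    · refine (ContDiff.fderiv (f := fun p : ℝ × ModelJet E => b (h (s₁ p.1))) (n := ∞) ?_
        contDiff_snd le_rfl).continuous
      exact hb.comp ((contDiff_fst.comp contDiff_fst).prodMk contDiff_snd)
    · have : b (h (s₁ 0)) = 0 := funext fun y => hb0 _ _ (by rw [hs₁z, hz0])
      simp [this]
    · have : b (h (s₁ t)) =ᶠ[𝓝 x] 0 := by
        filter_upwards [(hev (s₁ t) x hx).eventuallyEq_nhds] with y hy using hb0 _ _ hy
      rw [this.fderiv_eq]; simp
  obtain ⟨s₂, hs₂, hs₂0, hb₂⟩ := hslow ((key (contDiff_sourceShift hh₁ hb₁)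
    fun f x hf => (shifts_eq_zero_of_eventuallyEq hf).1).and (key (contDiff_targetShift hh₁)
    fun f x hf => (shifts_eq_zero_of_eventuallyEq hf).2.1))
  refine ⟨s₁ ∘ s₂, hs₁.comp hs₂, ?_, fun t => hb₁ _, fun t => (hb₂ t).1, fun t => (hb₂ t).2⟩
  have hs₂z : s₂ 0 = 0 := hs₂0.self_of_nhds
  have : Filter.Tendsto s₂ (𝓝 0) (𝓝 0) := by
    simpa [hs₂z] using hs₂.continuous.tendsto 0
  filter_upwards [hs₂0, this.eventually hs₁0] with t h1 h2
  rw [Function.comp_apply, h2, h1]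

/-- The target map is contact with respect to the source map, with conformal factor `1 - h_z`. -/
theorem modelForm_targetShift {h : ModelJet E → ℝ} (hh : ContDiff ℝ ∞ h) {w : ModelJet E}
    (hz : 1 - partialZ h w ≠ 0) {S T : ModelJet E →L[ℝ] ModelJet E}
    (hS : HasFDerivAt (fun x => x + sourceShift h x) S w)
    (hT : HasFDerivAt (fun x => x + targetShift h x) T w) (u : ModelJet E) :
    modelForm (w + targetShift h w) (T u) =
      (1 - partialZ h w) * modelForm (w + sourceShift h w) (S u) := by
  have hP : ContDiff ℝ ∞ (partialP h) :=
    (contDiff_partialP (h := fun _ => h) (hh.comp contDiff_snd)).comp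
      (contDiff_const (c := (0 : ℝ)).prodMk contDiff_id)
  have hPd := ((hP.differentiable (by simp)) w).hasFDerivAt
  have hhd := ((hh.differentiable (by simp)) w).hasFDerivAt
  have hp : HasFDerivAt (fun x : ModelJet E => x.1.2)
      ((ContinuousLinearMap.snd ℝ E _).comp (ContinuousLinearMap.fst ℝ _ ℝ)) w :=
    ((ContinuousLinearMap.snd ℝ E (E →L[ℝ] ℝ)).comp
      (ContinuousLinearMap.fst ℝ _ ℝ)).hasFDerivAt
  have hT' := (hasFDerivAt_id w).add ((hPd.prodMk (hasFDerivAt_const (0 : E →L[ℝ] ℝ) w)).prodMk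
    ((hp.clm_apply hPd).sub hhd))
  have hTu := congrArg (fun L : ModelJet E →L[ℝ] ModelJet E => L u) (hT.unique hT')
  have hS1 : (S u).1.1 = u.1.1 := by
    have h1 : HasFDerivAt (fun x : ModelJet E => (x + sourceShift h x).1.1) _ w :=
      ((ContinuousLinearMap.fst ℝ E (E →L[ℝ] ℝ)).comp
        (ContinuousLinearMap.fst ℝ _ ℝ)).hasFDerivAt.comp w hS
    have h2 : HasFDerivAt (fun x : ModelJet E => (x + sourceShift h x).1.1)
        ((ContinuousLinearMap.fst ℝ E (E →L[ℝ] ℝ)).comp (ContinuousLinearMap.fst ℝ _ ℝ)) w := by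
      have e : (fun x : ModelJet E => (x + sourceShift h x).1.1) =
          ((ContinuousLinearMap.fst ℝ E (E →L[ℝ] ℝ)).comp (ContinuousLinearMap.fst ℝ _ ℝ)) := by
        ext x; simp [sourceShift]
      rw [e]
      exact ContinuousLinearMap.hasFDerivAt _
    exact congrArg (fun L => L u) (h1.unique h2)
  have hS2 : (S u).2 = u.2 := by
    have h1 : HasFDerivAt (fun x : ModelJet E => (x + sourceShift h x).2) _ w :=
      (ContinuousLinearMap.snd ℝ (E × (E →L[ℝ] ℝ)) ℝ).hasFDerivAt.comp w hS
    have h2 : HasFDerivAt (fun x : ModelJet E => (x + sourceShift h x).2)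
        (ContinuousLinearMap.snd ℝ (E × (E →L[ℝ] ℝ)) ℝ) w := by
      simpa [sourceShift] using (ContinuousLinearMap.snd ℝ (E × (E →L[ℝ] ℝ)) ℝ).hasFDerivAt
    exact congrArg (fun L => L u) (h1.unique h2)
  have hd := fderiv_eq_partials h w u
  have e1 : (T u).1.1 = u.1.1 + fderiv ℝ (partialP h) w u := by rw [hTu]; rfl
  have e2 : (T u).2 = u.2 + (w.1.2 (fderiv ℝ (partialP h) w u) + u.1.2 (partialP h w)
      - fderiv ℝ h w u) := by rw [hTu]; rfl
  have e3 : (w + targetShift h w).1.2 = w.1.2 := by simp [targetShift]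
  have e4 : (w + sourceShift h w).1.2 = (1 - partialZ h w)⁻¹ • (w.1.2 + partialQ h w) := by
    simp [sourceShift]
  -- The target map pulls α back to P dq + P dh_P - dz - d(P h_P) + dh. The differentials of h_P
  -- cancel, and (P + h_q) dq - (1 - h_z) dz remains, which is 1 - h_z times the pullback by the
  -- source map.
  rw [modelForm, modelForm, hS1, hS2, e1, e2, e3, e4, hd]
  simp only [map_add, smul_apply, add_apply, smul_eq_mul]
  field_simp
  ring

omit [FiniteDimensional ℝ E] in
theorem base_eq_of_sourceShift {h : ModelJet E → ℝ} {w y : ModelJet E}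
    (e : w + sourceShift h w = y) : w.1.1 = y.1.1 ∧ w.2 = y.2 := by
  rw [← e]
  simp [sourceShift]

/-- A generating function that does not depend on `P` near `w` generates there the prolongation of
a shift of `z`. -/
theorem targetShift_of_eventually {h : ModelJet E → ℝ} (hh : ContDiff ℝ ∞ h) {w : ModelJet E}
    {k : E → ℝ → ℝ} (hk : ∀ᶠ v in 𝓝 w, h v = k v.1.1 v.2) :
    targetShift h w = (0, -k w.1.1 w.2) := by
  have h1 : (fderiv ℝ h w).comp ((ContinuousLinearMap.inl ℝ _ ℝ).comp
      (ContinuousLinearMap.inr ℝ E _)) = 0 := by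
    ext l
    -- The derivative in the fibre direction `l` vanishes because `h` is constant on short segments
    -- through `w` in that direction.
    have hl : HasDerivAt (fun τ : ℝ => h (w + τ • (((0, l), 0) : ModelJet E)))
        (fderiv ℝ h w ((0, l), 0)) 0 :=
      ((hh.differentiable (by simp)) w).hasFDerivAt.hasLineDerivAt _
    have hten : Filter.Tendsto (fun τ : ℝ => w + τ • (((0, l), 0) : ModelJet E)) (𝓝 0) (𝓝 w) := by
      have : Continuous fun τ : ℝ => w + τ • (((0, l), 0) : ModelJet E) := by fun_prop
      simpa using this.tendsto 0
    have hconst : (fun τ : ℝ => h (w + τ • (((0, l), 0) : ModelJet E))) =ᶠ[𝓝 0]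
        fun _ => k w.1.1 w.2 := by
      filter_upwards [hten.eventually hk] with τ hτ
      rw [hτ]
      simp
    exact hl.unique ((hasDerivAt_const (0 : ℝ) _).congr_of_eventuallyEq hconst)
  have hP0 : partialP h w = 0 := by rw [partialP, h1, map_zero]
  rw [targetShift, hP0, hk.self_of_nhds, map_zero, zero_sub]
  rfl

/-- The Hamiltonian at time `0` of the isotopy generated by a family of functions. -/
theorem modelForm_deriv_zero {g : ℝ → ModelJet E → ℝ} (hg : ContDiff ℝ ∞ (Function.uncurry g))
    (hg0 : ∀ x, g 0 x = 0) {G : ℝ → ModelJet E → ModelJet E}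
    (hG : ContDiff ℝ ∞ (Function.uncurry G)) (hG0 : ∀ x, G 0 x = x)
    (hGr : ∀ t y, G t y + sourceShift (g t) (G t y) = y) (x : ModelJet E) :
    modelForm x (deriv (fun t => G t x + targetShift (g t) (G t x)) 0) =
      deriv (fun t => g t x) 0 := by
  have hg0' : g 0 = 0 := funext hg0
  have hw0 := hG0 x
  have hline : HasDerivAt (fun t : ℝ => (t, x)) ((1 : ℝ), (0 : ModelJet E)) 0 :=
    (hasDerivAt_id 0).prodMk (hasDerivAt_const 0 x)
  set W := fderiv ℝ (Function.uncurry G) (0, x) (1, 0)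
  have hG1 : HasDerivAt (fun t => G t x) W 0 :=
    HasFDerivAt.comp_hasDerivAt (l := Function.uncurry G) 0
      ((hG.differentiable (by simp)) (0, x)).hasFDerivAt hline
  have hpath : HasDerivAt (fun t : ℝ => (t, G t x)) ((1 : ℝ), W) 0 :=
    (hasDerivAt_id 0).prodMk hG1
  set D := fderiv ℝ (fun p : ℝ × ModelJet E => partialP (g p.1) p.2) (0, G 0 x) (1, W)
  have hπ : HasDerivAt (fun t => partialP (g t) (G t x)) D 0 :=
    HasFDerivAt.comp_hasDerivAt (l := fun p : ℝ × ModelJet E => partialP (g p.1) p.2) 0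
      (((contDiff_partialP hg).differentiable (by simp)) (0, G 0 x)).hasFDerivAt hpath
  have hgd : HasFDerivAt (Function.uncurry g) _ (0, x) :=
    ((hg.differentiable (by simp)) (0, x)).hasFDerivAt
  -- The velocity `W` of the moving point does not contribute, since `g` vanishes identically at
  -- time `0`.
  have hgW : fderiv ℝ (Function.uncurry g) (0, x) (0, W) = 0 := by
    have h1 : HasFDerivAt (g 0) _ x := hgd.comp x (hasFDerivAt_prodMk_right (0 : ℝ) x)
    have h2 : HasFDerivAt (g 0) (0 : ModelJet E →L[ℝ] ℝ) x :=
      (hasFDerivAt_const (0 : ℝ) x).congr_of_eventuallyEq (by rw [hg0']; rfl)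
    simpa using congrArg (fun L : ModelJet E →L[ℝ] ℝ => L W) (h1.unique h2)
  have hgt0 : HasDerivAt (fun t => g t x) (fderiv ℝ (Function.uncurry g) (0, x) (1, 0)) 0 :=
    HasFDerivAt.comp_hasDerivAt (l := Function.uncurry g) 0 hgd hline
  have hgpath : HasDerivAt (fun t => g t (G t x)) (deriv (fun t => g t x) 0) 0 := by
    have h1 : HasDerivAt (fun t => g t (G t x))
        (fderiv ℝ (Function.uncurry g) (0, x) (1, W)) 0 :=
      HasFDerivAt.comp_hasDerivAt (l := Function.uncurry g) (f := fun t : ℝ => (t, G t x)) 0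
        (by rw [hw0]; exact hgd) hpath
    rw [hgt0.deriv]
    have h2 : ((1 : ℝ), W) = (1, 0) + (0, W) := by simp
    rwa [h2, map_add, hgW, add_zero] at h1
  have hP : HasDerivAt (fun t => (G t x).1.2) W.1.2 0 :=
    ((ContinuousLinearMap.snd ℝ E (E →L[ℝ] ℝ)).comp
      (ContinuousLinearMap.fst ℝ _ ℝ)).hasFDerivAt.comp_hasDerivAt 0 hG1
  have hcz := ((hP.clm_apply hπ).sub hgpath).const_add x.2
  have hcq := hπ.const_add x.1.1
  have hc : ContDiff ℝ ∞ (Function.uncurry fun t x => G t x + targetShift (g t) (G t x)) :=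
    hG.add ((contDiff_targetShift hg).comp (contDiff_fst.prodMk hG))
  set c₁ := fderiv ℝ (Function.uncurry fun t x => G t x + targetShift (g t) (G t x)) (0, x) (1, 0)
  have hcd : HasDerivAt (fun t => G t x + targetShift (g t) (G t x)) c₁ 0 :=
    HasFDerivAt.comp_hasDerivAt
      (l := Function.uncurry fun t x => G t x + targetShift (g t) (G t x)) 0
      ((hc.differentiable (by simp)) (0, x)).hasFDerivAt hline
  have hq : HasDerivAt (fun t => x.1.1 + partialP (g t) (G t x)) c₁.1.1 0 := by
    have h1 : HasDerivAt (fun t => (G t x + targetShift (g t) (G t x)).1.1) c₁.1.1 0 :=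
      ((ContinuousLinearMap.fst ℝ E (E →L[ℝ] ℝ)).comp
        (ContinuousLinearMap.fst ℝ _ ℝ)).hasFDerivAt.comp_hasDerivAt 0 hcd
    convert h1 using 2 with t
    obtain ⟨e1, -⟩ := base_eq_of_sourceShift (hGr t x)
    simp [targetShift, e1]
  have hzz : HasDerivAt (fun t => x.2 + ((G t x).1.2 (partialP (g t) (G t x)) - g t (G t x)))
      c₁.2 0 := by
    have h1 : HasDerivAt (fun t => (G t x + targetShift (g t) (G t x)).2) c₁.2 0 :=
      (ContinuousLinearMap.snd ℝ (E × (E →L[ℝ] ℝ)) ℝ).hasFDerivAt.comp_hasDerivAt 0 hcd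
    convert h1 using 2 with t
    obtain ⟨-, e2⟩ := base_eq_of_sourceShift (hGr t x)
    simp [targetShift, e2]
  have hP0 : partialP (g 0) (G 0 x) = 0 := by
    have : fderiv ℝ (g 0) (G 0 x) = 0 := by rw [hg0']; simp
    simp [partialP, this]
  -- The velocity has q-component `D` and z-component P·D + Ṗ(g_P) - ġ. As g_P = 0 at time `0`, the
  -- value of p dq - dz on it is ġ.
  rw [hcd.deriv, modelForm, hq.unique hcq, hzz.unique hcz, hP0, hw0, map_zero]
  ring

/-- A compactly supported family of functions generates a compactly supported contact isotopy of
the model, whose Hamiltonian at time `0` is the time derivative of the family. -/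
theorem exists_modelIsotopy {h : ℝ → ModelJet E → ℝ} (hh : ContDiff ℝ ∞ (Function.uncurry h))
    (h0 : ∀ x, h 0 x = 0) {C : Set (ModelJet E)} (hC : IsCompact C)
    (hsupp : ∀ t, ∀ x ∉ C, h t x = 0) :
    ∃ c c' : ℝ → ModelJet E → ModelJet E, ContDiff ℝ ∞ (Function.uncurry c) ∧
      ContDiff ℝ ∞ (Function.uncurry c') ∧ (∀ t x, c' t (c t x) = x) ∧ (∀ t x, c t (c' t x) = x) ∧
      (∀ x, c 0 x = x) ∧ (∀ t, ∀ x ∉ C, c t x = x) ∧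
      (∀ t x v, modelForm (c t x) (fderiv ℝ (c t) x v) = 0 ↔ modelForm x v = 0) ∧
      (∀ x, modelForm x (deriv (fun t => c t x) 0) = deriv (fun t => h t x) 0) ∧
      ∀ (k : ℝ → E → ℝ → ℝ) (x : ModelJet E), (∀ᶠ w in 𝓝 x, ∀ t, h t w = k t w.1.1 w.2) →
        ∀ᶠ p : ℝ × ModelJet E in 𝓝 (0, x), (c p.1 p.2).1.1 = p.2.1.1 ∧
          (c p.1 p.2).2 = p.2.2 - k p.1 p.2.1.1 p.2.2 := by
  obtain ⟨s, hs, hs0, hz, hSd, hTd⟩ := exists_slowdown hh h0 hC hsupp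
  set g : ℝ → ModelJet E → ℝ := fun t => h (s t) with hgdef
  have hg : ContDiff ℝ ∞ (Function.uncurry g) :=
    hh.comp ((hs.comp contDiff_fst).prodMk contDiff_snd)
  have hs00 : s 0 = 0 := hs0.self_of_nhds
  have hgt : ∀ t, ContDiff ℝ ∞ (g t) := fun t => hg.comp (contDiff_const.prodMk contDiff_id)
  have hS := contDiff_sourceShift hg hz
  have hT := contDiff_targetShift hg
  obtain ⟨G, hG, hGl, hGr⟩ := exists_contDiff_inverse_of_fderiv_le hS hSd
  obtain ⟨G', hG', hGl', hGr'⟩ := exists_contDiff_inverse_of_fderiv_le hT hTd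
  have hzne : ∀ t x, 1 - partialZ (g t) x ≠ 0 := fun t x => by
    have := le_abs_self (partialZ (g t) x)
    linarith [hz t x]
  have hev : ∀ t, ∀ x ∉ C, g t =ᶠ[𝓝 x] 0 := fun t x hx => by
    filter_upwards [hC.isClosed.isOpen_compl.mem_nhds hx] with y hy using hsupp _ y hy
  have hev0 : ∀ x, g 0 =ᶠ[𝓝 x] 0 := fun x =>
    Filter.Eventually.of_forall fun y => by simp [hgdef, hs00, h0]
  have hfix : ∀ t x, g t =ᶠ[𝓝 x] 0 → G t x + targetShift (g t) (G t x) = x := fun t x hx => by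
    have h1 : G t x = x := by
      conv_lhs => rw [← add_zero x, ← (shifts_eq_zero_of_eventuallyEq hx).1]
      exact hGl t x
    rw [h1, (shifts_eq_zero_of_eventuallyEq hx).2.1, add_zero]
  have hG0 : ∀ x, G 0 x = x := fun x => by
    conv_lhs => rw [← add_zero x, ← (shifts_eq_zero_of_eventuallyEq (hev0 x)).1]
    exact hGl 0 x
  have hpair : ∀ {f : ℝ → ModelJet E → ModelJet E}, ContDiff ℝ ∞ (Function.uncurry f) →
      ContDiff ℝ ∞ (fun p : ℝ × ModelJet E => (p.1, f p.1 p.2)) := fun hf => contDiff_fst.prodMk hf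
  have hslice : ∀ {f : ℝ → ModelJet E → ModelJet E}, ContDiff ℝ ∞ (Function.uncurry f) →
      ∀ t x, HasFDerivAt (f t) (fderiv ℝ (f t) x) x := fun hf t x =>
    (((hf.comp (contDiff_const.prodMk contDiff_id : ContDiff ℝ ∞ fun x => (t, x))).differentiable
      (by simp)) x).hasFDerivAt
  have hc : ContDiff ℝ ∞ (Function.uncurry fun t x => G t x + targetShift (g t) (G t x)) :=
    hG.add (hT.comp (hpair hG))
  -- The isotopy is the target map after the inverse of the source map; its inverse is the source
  -- map after the inverse of the target map.
  refine ⟨fun t x => G t x + targetShift (g t) (G t x),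
    fun t x => G' t x + sourceShift (g t) (G' t x), hc, hG'.add (hS.comp (hpair hG')),
    fun t x => by simp only [hGl', hGr], fun t x => by simp only [hGl, hGr'],
    fun x => hfix 0 x (hev0 x), fun t x hx => hfix t x (hev t x hx), fun t x v => ?_,
    fun x => ?_, fun k x hk => ?_⟩
  · have hSw := (hasFDerivAt_id (G t x)).add (hslice hS t (G t x))
    have hTw := (hasFDerivAt_id (G t x)).add (hslice hT t (G t x))
    have hGx := hslice hG t x
    have hcx : HasFDerivAt (fun x => G t x + targetShift (g t) (G t x)) _ x := hTw.comp x hGx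
    have hid : HasFDerivAt (fun x => G t x + sourceShift (g t) (G t x)) _ x := hSw.comp x hGx
    have hid' := hid.unique ((hasFDerivAt_id x).congr_of_eventuallyEq
      (Filter.Eventually.of_forall fun y => hGr t y))
    have hv := congrArg (fun L : ModelJet E →L[ℝ] ModelJet E => L v) hid'
    simp only [ContinuousLinearMap.comp_apply, ContinuousLinearMap.id_apply] at hv
    have key := modelForm_targetShift (hgt t) (hzne t (G t x)) hSw hTw (fderiv ℝ (G t) x v)
    rw [hcx.fderiv, ContinuousLinearMap.comp_apply, key, hv, hGr, mul_eq_zero]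
    simp [hzne]
  · rw [modelForm_deriv_zero hg (fun x => (hev0 x).self_of_nhds) hG hG0 hGr]
    apply Filter.EventuallyEq.deriv_eq
    filter_upwards [hs0] with t ht
    simp [hgdef, ht]
  · have hGt : Filter.Tendsto (Function.uncurry G) (𝓝 (0, x)) (𝓝 x) := by
      have := hG.continuous.tendsto (0, x)
      rwa [Function.uncurry_apply_pair, hG0] at this
    -- For small times the slowdown is the identity and `G t y` stays where `h` is independent of P,
    -- so the target map only shifts `z`; the source map changes neither `q` nor `z`.
    filter_upwards [hGt.eventually hk.eventually_nhds,
      (continuous_fst.tendsto ((0 : ℝ), x)).eventually hs0] with p hp hsp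
    obtain ⟨t, y⟩ := p
    simp only [Function.uncurry_apply_pair] at hp hsp
    obtain ⟨e1, e2⟩ := base_eq_of_sourceShift (hGr t y)
    have e3 := targetShift_of_eventually (k := k t) (hgt t) (hp.mono fun v hv => by
      simpa [hgdef, hsp] using hv t)
    simp [e3, e1, e2, sub_eq_add_neg]

end Generating

/-! ## Charts of the 1-jet bundle -/

section JetChart

variable {n : ℕ} {N : Type*} [TopologicalSpace N] [ChartedSpace (EuclideanSpace ℝ (Fin n)) N]
  [IsManifold (𝓡 n) ∞ N]

theorem isManifold_one_of_infty : IsManifold (𝓡 n) 1 N :=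
  IsManifold.of_le (n := ∞) (by simp)

/-- The chart of the 1-jet bundle induced by the chart of `N` at `q₀`. -/
def jetChart (n : ℕ) {N : Type*} [TopologicalSpace N] [ChartedSpace (EuclideanSpace ℝ (Fin n)) N]
    [IsManifold (𝓡 n) ∞ N] (q₀ : N) :
    PartialEquiv (JetBundle n N) (ModelJet (EuclideanSpace ℝ (Fin n))) :=
  extChartAt (jetModel n) ((⟨q₀, 0⟩, 0) : JetBundle n N)

theorem jetChart_source (q₀ : N) :
    (jetChart n q₀).source = {x | x.1.proj ∈ (chartAt (EuclideanSpace ℝ (Fin n)) q₀).source} := by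
  ext x
  rw [jetChart, extChartAt_source, prodChartedSpace_chartAt, OpenPartialHomeomorph.prod_source,
    chartAt_self_eq, mem_prod, FiberBundle.chartedSpace_chartAt]
  simp only [OpenPartialHomeomorph.trans_source, OpenPartialHomeomorph.refl_source, mem_univ,
    and_true, OpenPartialHomeomorph.prod_source, mem_inter_iff, mem_preimage, mem_prod, mem_ofPred_eq]
  constructor
  · intro h
    simpa using h.1
  · intro h
    have h' : x.1 ∈ (trivializationAt (EuclideanSpace ℝ (Fin n) →L[ℝ] ℝ)
        (fun q : N => CotangentSpace n q) q₀).source := by simpa using h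
    refine ⟨h', ?_⟩
    change ((trivializationAt (EuclideanSpace ℝ (Fin n) →L[ℝ] ℝ)
        (fun q : N => CotangentSpace n q) q₀) x.1).1 ∈ _
    rwa [Bundle.Trivialization.coe_fst _ h']

theorem isOpen_jetChart_source (q₀ : N) : IsOpen (jetChart n q₀).source :=
  isOpen_extChartAt_source _

theorem isOpen_jetChart_target (q₀ : N) : IsOpen (jetChart n q₀).target :=
  isOpen_extChartAt_target _

theorem jetChart_fst_fst (q₀ : N) (x : JetBundle n N) :
    (jetChart n q₀ x).1.1 = extChartAt (𝓡 n) q₀ x.1.proj := by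
  rfl

theorem jetChart_snd (q₀ : N) (x : JetBundle n N) : (jetChart n q₀ x).2 = x.2 := by
  rfl

theorem jetChart_fst_snd (q₀ : N) (x : JetBundle n N) :
    (jetChart n q₀ x).1.2 = ContinuousLinearMap.inCoordinates (EuclideanSpace ℝ (Fin n))
      (TangentSpace (𝓡 n)) ℝ (fun _ : N => ℝ) q₀ x.1.proj q₀ x.1.proj x.1.snd := by
  rfl

/-- The jet chart is the cotangent lift of the base chart: covectors are transported so that their
pairing with vectors is preserved. This is why α becomes p dq - dz in the chart. -/
theorem jetChart_fst_snd_apply {q₀ : N} {x : JetBundle n N}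
    (hx : x ∈ (jetChart n q₀).source) (w : TangentSpace (𝓡 n) x.1.proj) :
    haveI := isManifold_one_of_infty (n := n) (N := N)
    (jetChart n q₀ x).1.2 (mfderiv (𝓡 n) 𝓘(ℝ, EuclideanSpace ℝ (Fin n)) (extChartAt (𝓡 n) q₀)
      x.1.proj w) = x.1.snd w := by
  have := isManifold_one_of_infty (n := n) (N := N)
  rw [jetChart_source] at hx
  rw [jetChart_fst_snd, ContinuousLinearMap.inCoordinates_eq hx (mem_univ _),
    ← TangentBundle.continuousLinearMapAt_trivializationAt hx]
  have h : Bundle.Trivialization.continuousLinearMapAt ℝ (trivializationAt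
      (EuclideanSpace ℝ (Fin n)) (TangentSpace (𝓡 n)) q₀) x.1.proj w =
      Bundle.Trivialization.continuousLinearEquivAt ℝ (trivializationAt (EuclideanSpace ℝ (Fin n))
        (TangentSpace (𝓡 n)) q₀) x.1.proj hx w := by
    rw [← Bundle.Trivialization.coe_continuousLinearEquivAt_eq _ hx]
  set e := Bundle.Trivialization.continuousLinearEquivAt ℝ (trivializationAt
    (EuclideanSpace ℝ (Fin n)) (TangentSpace (𝓡 n)) q₀) x.1.proj hx
  exact (congrArg (fun u => x.1.snd (e.symm u)) h).trans
    (congrArg x.1.snd (e.symm_apply_apply w))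

theorem mdifferentiableAt_proj (x : JetBundle n N) :
    MDifferentiableAt (jetModel n) (𝓡 n) (fun y : JetBundle n N => y.1.proj) x := by
  have h : ContMDiff (jetModel n) (𝓡 n) ∞ (fun y : JetBundle n N => y.1.proj) :=
    (Bundle.contMDiff_proj (fun q : N => CotangentSpace n q)).comp contMDiff_fst
  exact h.mdifferentiableAt (by simp)

theorem mdifferentiableAt_jetChart {q₀ : N} {x : JetBundle n N}
    (hx : x ∈ (jetChart n q₀).source) :
    MDifferentiableAt (jetModel n) 𝓘(ℝ, ModelJet (EuclideanSpace ℝ (Fin n))) (jetChart n q₀) x := by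
  have := isManifold_one_of_infty (n := n) (N := N)
  have : IsManifold (jetModel n) 1 (JetBundle n N) := IsManifold.of_le (n := ∞) (by simp)
  refine mdifferentiableAt_extChartAt ?_
  rwa [← extChartAt_source (jetModel n)]

/-- In a jet chart the standard contact form is the model form. -/
theorem stdContactForm_eq_modelForm {q₀ : N} {x : JetBundle n N}
    (hx : x ∈ (jetChart n q₀).source) (v : TangentSpace (jetModel n) x) :
    stdContactForm n N x v = modelForm (jetChart n q₀ x)
      (mfderiv (jetModel n) 𝓘(ℝ, ModelJet (EuclideanSpace ℝ (Fin n))) (jetChart n q₀) x v) := by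
  have hN := isManifold_one_of_infty (n := n) (N := N)
  have hx' := hx
  rw [jetChart_source] at hx'
  have hd := (mdifferentiableAt_jetChart hx).hasMFDerivAt
  set L := mfderiv (jetModel n) 𝓘(ℝ, ModelJet (EuclideanSpace ℝ (Fin n))) (jetChart n q₀) x
  have h1 : (L v).1.1 = mfderiv (𝓡 n) 𝓘(ℝ, EuclideanSpace ℝ (Fin n)) (extChartAt (𝓡 n) q₀)
      x.1.proj (mfderiv (jetModel n) (𝓡 n) (fun y : JetBundle n N => y.1.proj) x v) := by
    have e1 := (mdifferentiableAt_extChartAt hx' (I := 𝓡 n)).hasMFDerivAt.comp x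
      (mdifferentiableAt_proj x).hasMFDerivAt
    have e2 := (((ContinuousLinearMap.fst ℝ (EuclideanSpace ℝ (Fin n)) _).comp
      (ContinuousLinearMap.fst ℝ _ ℝ)).hasMFDerivAt (x := jetChart n q₀ x)).comp x hd
    exact congrArg (fun L => L v) (hasMFDerivAt_unique e2 e1)
  have h2 : (L v).2 = mvfderiv (jetModel n) (fun y : JetBundle n N => y.2) x v := by
    have e1 : HasMFDerivAt (jetModel n) 𝓘(ℝ, ℝ) (fun y : JetBundle n N => y.2) x _ :=
      mdifferentiableAt_snd.hasMFDerivAt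
    have e2 := ((ContinuousLinearMap.snd ℝ (EuclideanSpace ℝ (Fin n) ×
      (EuclideanSpace ℝ (Fin n) →L[ℝ] ℝ)) ℝ).hasMFDerivAt (x := jetChart n q₀ x)).comp x hd
    exact congrArg (fun L => L v) (hasMFDerivAt_unique e2 e1)
  change _ = (jetChart n q₀ x).1.2 (L v).1.1 - (L v).2
  rw [h1, h2, jetChart_fst_snd_apply hx]
  rfl

section Maps

variable {E : Type*} [NormedAddCommGroup E] [NormedSpace ℝ E] {H : Type*} [TopologicalSpace H]
  {I : ModelWithCorners ℝ E H} {M : Type*} [TopologicalSpace M] [ChartedSpace H M]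

theorem stdContactForm_mfderiv {q₀ : N} {f : M → JetBundle n N} {x : M}
    (hf : MDifferentiableAt I (jetModel n) f x) (hx : f x ∈ (jetChart n q₀).source)
    (v : TangentSpace I x) :
    stdContactForm n N (f x) (mfderiv I (jetModel n) f x v) = modelForm (jetChart n q₀ (f x))
      (mfderiv I 𝓘(ℝ, ModelJet (EuclideanSpace ℝ (Fin n))) (fun y => jetChart n q₀ (f y)) x v) := by
  rw [stdContactForm_eq_modelForm hx]
  congr 1
  exact (congrArg (fun L => L v) (mfderiv_comp x (mdifferentiableAt_jetChart hx) hf)).symm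

end Maps

theorem stdContactForm_velocity {q₀ : N} {γ : ℝ → JetBundle n N} {t : ℝ}
    (hγ : MDifferentiableAt 𝓘(ℝ, ℝ) (jetModel n) γ t) (hx : γ t ∈ (jetChart n q₀).source) :
    stdContactForm n N (γ t) (mfderiv 𝓘(ℝ, ℝ) (jetModel n) γ t (1 : ℝ)) =
      modelForm (jetChart n q₀ (γ t)) (deriv (fun s => jetChart n q₀ (γ s)) t) := by
  refine (stdContactForm_mfderiv hγ hx (1 : ℝ)).trans (congrArg (modelForm _) ?_)
  exact congrArg (fun L : ℝ →L[ℝ] ModelJet (EuclideanSpace ℝ (Fin n)) => L 1) mfderiv_eq_fderiv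

theorem contMDiffOn_jetChart (q₀ : N) : ContMDiffOn (jetModel n)
    𝓘(ℝ, ModelJet (EuclideanSpace ℝ (Fin n))) ∞ (jetChart n q₀) (jetChart n q₀).source := by
  rw [jetChart, extChartAt_source]
  exact contMDiffOn_extChartAt

theorem contMDiffAt_jetChart {q₀ : N} {x : JetBundle n N} (hx : x ∈ (jetChart n q₀).source) :
    ContMDiffAt (jetModel n) 𝓘(ℝ, ModelJet (EuclideanSpace ℝ (Fin n))) ∞ (jetChart n q₀) x :=
  (contMDiffOn_jetChart q₀).contMDiffAt ((isOpen_jetChart_source q₀).mem_nhds hx)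

theorem contMDiffOn_jetChart_symm (q₀ : N) : ContMDiffOn
    𝓘(ℝ, ModelJet (EuclideanSpace ℝ (Fin n))) (jetModel n) ∞ (jetChart n q₀).symm
    (jetChart n q₀).target :=
  contMDiffOn_extChartAt_symm _

/-- The Hamiltonian of a smooth family of maps is continuous in time and space. -/
theorem continuous_stdContactForm_velocity {ψ : ℝ → JetBundle n N → JetBundle n N}
    (hψ : ContMDiff (𝓘(ℝ, ℝ).prod (jetModel n)) (jetModel n) ∞ (Function.uncurry ψ)) :
    Continuous fun p : ℝ × JetBundle n N => stdContactForm n N (ψ p.1 p.2)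
      (mfderiv 𝓘(ℝ, ℝ) (jetModel n) (fun s => ψ s p.2) p.1 (1 : ℝ)) := by
  have hJ : IsManifold (jetModel n) 1 (JetBundle n N) := IsManifold.of_le (n := ∞) (by simp)
  rw [continuous_iff_continuousAt]
  intro p₀
  set q₀ := (ψ p₀.1 p₀.2).1.proj
  have hmem : ψ p₀.1 p₀.2 ∈ (jetChart n q₀).source := by
    rw [jetChart_source]; exact mem_chart_source _ _
  have hev : ∀ᶠ p in 𝓝 p₀, Function.uncurry ψ p ∈ (jetChart n q₀).source :=
    hψ.continuous.continuousAt.eventually_mem ((isOpen_jetChart_source q₀).mem_nhds hmem)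
  have hpath : ∀ x t, MDifferentiableAt 𝓘(ℝ, ℝ) (jetModel n) (fun s => ψ s x) t := fun x t =>
    (hψ.comp (contMDiff_id.prodMk contMDiff_const)).mdifferentiableAt (by simp)
  have hΦ : ContMDiffAt (𝓘(ℝ, ℝ).prod (jetModel n)) 𝓘(ℝ, ModelJet (EuclideanSpace ℝ (Fin n))) ∞
      (fun p : ℝ × JetBundle n N => jetChart n q₀ (ψ p.1 p.2)) p₀ :=
    ContMDiffAt.comp p₀ (contMDiffAt_jetChart hmem) hψ.contMDiffAt
  -- Smooth dependence of a derivative on parameters: the differentiation time `s` is kept separate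
  -- from the parameter `p` and then evaluated at `p.1`.
  have hder := ContMDiffAt.mfderiv (J := 𝓘(ℝ, ℝ).prod (jetModel n)) (I := 𝓘(ℝ, ℝ))
    (I' := 𝓘(ℝ, ModelJet (EuclideanSpace ℝ (Fin n)))) (m := 0) (n := ∞) (x₀ := p₀)
    (fun (p : ℝ × JetBundle n N) (s : ℝ) => jetChart n q₀ (ψ s p.2)) (fun p => p.1)
    (ContMDiffAt.comp (g := fun p : ℝ × JetBundle n N => jetChart n q₀ (ψ p.1 p.2))
      (f := fun p : (ℝ × JetBundle n N) × ℝ => (p.2, p.1.2)) (p₀, p₀.1) hΦ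
      (contMDiff_snd.prodMk (contMDiff_snd.comp contMDiff_fst)).contMDiffAt)
    contMDiffAt_fst (by simp)
  have heq := inTangentCoordinates_model_space (I := 𝓘(ℝ, ℝ))
    (I' := 𝓘(ℝ, ModelJet (EuclideanSpace ℝ (Fin n)))) (fun p : ℝ × JetBundle n N => p.1)
    (fun p => jetChart n q₀ (ψ p.1 p.2))
    (fun p => fderiv ℝ (fun s => jetChart n q₀ (ψ s p.2)) p.1) p₀
  have hcont : ContinuousAt (fun p : ℝ × JetBundle n N =>
      deriv (fun s => jetChart n q₀ (ψ s p.2)) p.1) p₀ := by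
    have h1 := hder.continuousAt
    simp only [mfderiv_eq_fderiv] at h1
    have h2 : ContinuousAt (fun p : ℝ × JetBundle n N =>
        fderiv ℝ (fun s => jetChart n q₀ (ψ s p.2)) p.1) p₀ :=
      (congrArg (fun F => ContinuousAt F p₀) heq).mp h1
    exact ContinuousAt.clm_apply h2 continuousAt_const
  have hΦc := hΦ.continuousAt
  have hform : ContinuousAt (fun p : ℝ × JetBundle n N => modelForm (jetChart n q₀ (ψ p.1 p.2))
      (deriv (fun s => jetChart n q₀ (ψ s p.2)) p.1)) p₀ :=
    (hΦc.fst.snd.clm_apply hcont.fst.fst).sub hcont.snd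
  refine hform.congr ?_
  filter_upwards [hev] with p hp
  exact (stdContactForm_velocity (hpath p.2 p.1) hp).symm

/-! ### Fibrewise rescaling -/

/-- The rescaling `(q, p, z) ↦ (q, l p, l z)` of the 1-jet bundle. -/
def jetScale (l : ℝ) (x : JetBundle n N) : JetBundle n N := (⟨x.1.proj, l • x.1.snd⟩, l * x.2)

omit [IsManifold (𝓡 n) ∞ N] in
theorem jetScale_jetScale (l m : ℝ) (x : JetBundle n N) :
    jetScale l (jetScale m x) = jetScale (l * m) x := by
  simp [jetScale, mul_smul, mul_assoc]
  rfl

omit [IsManifold (𝓡 n) ∞ N] in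
theorem jetScale_one (x : JetBundle n N) : jetScale 1 x = x := by
  simp [jetScale]

/-- The rescaling of the model. -/
def modelScale (E : Type*) [NormedAddCommGroup E] [NormedSpace ℝ E] (l : ℝ) :
    ModelJet E →L[ℝ] ModelJet E :=
  (((ContinuousLinearMap.fst ℝ E _).comp (ContinuousLinearMap.fst ℝ _ ℝ)).prod
    (l • (ContinuousLinearMap.snd ℝ E _).comp (ContinuousLinearMap.fst ℝ _ ℝ))).prod
    (l • ContinuousLinearMap.snd ℝ _ ℝ)

theorem jetChart_jetScale (q₀ : N) (l : ℝ) (x : JetBundle n N) :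
    jetChart n q₀ (jetScale l x) = modelScale _ l (jetChart n q₀ x) := by
  refine Prod.ext (Prod.ext rfl ?_) rfl
  rw [jetChart_fst_snd]
  change _ = l • (jetChart n q₀ x).1.2
  rw [jetChart_fst_snd]
  simp [jetScale, ContinuousLinearMap.inCoordinates]

theorem contMDiff_jetScale (l : ℝ) :
    ContMDiff (jetModel n) (jetModel n) ∞ (jetScale l : JetBundle n N → JetBundle n N) := by
  intro x
  have hx : x ∈ (jetChart n x.1.proj).source := by
    rw [jetChart_source]; exact mem_chart_source _ _
  have hlx : ∀ y, y ∈ (jetChart n x.1.proj).source → jetScale l y ∈ (jetChart n x.1.proj).source :=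
    fun y hy => by rw [jetChart_source] at hy ⊢; exact hy
  have hf : ContMDiffAt (jetModel n) (jetModel n) ∞ (fun y : JetBundle n N =>
      (jetChart n x.1.proj).symm (modelScale _ l (jetChart n x.1.proj y))) x := by
    refine ContMDiffAt.comp x ((contMDiffOn_jetChart_symm x.1.proj).contMDiffAt
      ((isOpen_jetChart_target _).mem_nhds ?_))
      ((modelScale _ l).contMDiff.contMDiffAt.comp x (contMDiffAt_jetChart hx))
    rw [← jetChart_jetScale]
    exact (jetChart n x.1.proj).map_source (hlx x hx)
  refine hf.congr_of_eventuallyEq ?_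
  filter_upwards [(isOpen_jetChart_source x.1.proj).mem_nhds hx] with y hy
  rw [← jetChart_jetScale, (jetChart n x.1.proj).left_inv (hlx y hy)]

section Maps

variable {E : Type*} [NormedAddCommGroup E] [NormedSpace ℝ E] {H : Type*} [TopologicalSpace H]
  {I : ModelWithCorners ℝ E H} {M : Type*} [TopologicalSpace M] [ChartedSpace H M]

theorem stdContactForm_jetScale_comp (l : ℝ) {f : M → JetBundle n N} {x : M}
    (hf : MDifferentiableAt I (jetModel n) f x) (v : TangentSpace I x) :
    stdContactForm n N (jetScale l (f x)) (mfderiv I (jetModel n) (fun y => jetScale l (f y)) x v) =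
      l * stdContactForm n N (f x) (mfderiv I (jetModel n) f x v) := by
  have hx : f x ∈ (jetChart n (f x).1.proj).source := by
    rw [jetChart_source]; exact mem_chart_source _ _
  have hlx : jetScale l (f x) ∈ (jetChart n (f x).1.proj).source := by
    rw [jetChart_source] at hx ⊢; exact hx
  have hl : MDifferentiableAt (jetModel n) (jetModel n) (jetScale l) (f x) :=
    (contMDiff_jetScale l).mdifferentiableAt (by simp)
  have hcomp : MDifferentiableAt I (jetModel n) (fun y => jetScale l (f y)) x := hl.comp x hf
  rw [stdContactForm_mfderiv hcomp hlx, stdContactForm_mfderiv hf hx]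
  have hfun : (fun y => jetChart n (f x).1.proj (jetScale l (f y))) =
      modelScale (EuclideanSpace ℝ (Fin n)) l ∘ (jetChart n (f x).1.proj ∘ f) :=
    funext fun y => jetChart_jetScale _ _ _
  have hS : HasMFDerivAt 𝓘(ℝ, ModelJet (EuclideanSpace ℝ (Fin n)))
      𝓘(ℝ, ModelJet (EuclideanSpace ℝ (Fin n))) (modelScale (EuclideanSpace ℝ (Fin n)) l)
      (jetChart n (f x).1.proj (f x)) (modelScale (EuclideanSpace ℝ (Fin n)) l) :=
    (modelScale (EuclideanSpace ℝ (Fin n)) l).hasMFDerivAt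
  have hd := hS.comp x ((mdifferentiableAt_jetChart hx).comp x hf).hasMFDerivAt
  rw [hfun, jetChart_jetScale]
  have hv := congrArg (fun L => L v) hd.mfderiv
  refine (congrArg (modelForm _) hv).trans ?_
  set y := jetChart n (f x).1.proj (f x)
  set w : ModelJet (EuclideanSpace ℝ (Fin n)) := mfderiv I 𝓘(ℝ, ModelJet (EuclideanSpace ℝ (Fin n)))
    (fun y => jetChart n (f x).1.proj (f y)) x v
  change (l • y.1.2) w.1.1 - l * w.2 = l * (y.1.2 w.1.1 - w.2)
  simp [mul_sub]

end Maps

/-- Points of different fibres are separated in the base, points of one fibre in a local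
trivialization. Hausdorffness makes compact supports closed, as extension by the identity requires.
-/
theorem t2Space_totalSpace {B F : Type*} [TopologicalSpace B] [TopologicalSpace F] {E : B → Type*}
    [TopologicalSpace (Bundle.TotalSpace F E)] [∀ b, TopologicalSpace (E b)] [FiberBundle F E]
    [T2Space B] [T2Space F] : T2Space (Bundle.TotalSpace F E) := by
  refine ⟨fun x y hxy => ?_⟩
  by_cases h : x.proj = y.proj
  · set e := trivializationAt F E x.proj
    have hx : x ∈ e.source := FiberBundle.mem_trivializationAt_proj_source
    have hy : y ∈ e.source := by
      rw [e.mem_source, ← h]; exact FiberBundle.mem_baseSet_trivializationAt F E x.proj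
    obtain ⟨u, v, hu, hv, hxu, hyv, huv⟩ :=
      t2_separation (show e x ≠ e y from fun he => hxy (e.injOn hx hy he))
    refine ⟨e.source ∩ e ⁻¹' u, e.source ∩ e ⁻¹' v,
      e.toOpenPartialHomeomorph.isOpen_inter_preimage hu,
      e.toOpenPartialHomeomorph.isOpen_inter_preimage hv, ⟨hx, hxu⟩, ⟨hy, hyv⟩, ?_⟩
    exact (huv.preimage e).mono inter_subset_right inter_subset_right
  · exact separated_by_continuous (FiberBundle.continuous_proj F E) h

instance [T2Space N] : T2Space (JetBundle n N) :=
  haveI : T2Space (CotangentBundle n N) := t2Space_totalSpace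
  inferInstance

end JetChart

/-! ## Isotopies with all real times, and the contactomorphisms they reach -/

section Reach

variable {E : Type*} [NormedAddCommGroup E] [NormedSpace ℝ E]
  {H : Type*} [TopologicalSpace H] {I : ModelWithCorners ℝ E H}
  {M : Type*} [TopologicalSpace M] [ChartedSpace H M]

omit [ChartedSpace H M] in
theorem OneForm.congr_apply [ChartedSpace H M] (α : OneForm I M) {x y : M} (h : x = y) {u v : E}
    (huv : u = v) : (α x : E →L[ℝ] ℝ) u = (α y : E →L[ℝ] ℝ) v := by
  subst h huv
  rfl

theorem IsContactomorphism.mdifferentiableAt {α : OneForm I M} {f : M → M}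
    (hf : IsContactomorphism α f) (x : M) : MDifferentiableAt I I f x := by
  obtain ⟨⟨F, rfl⟩, -⟩ := hf
  exact F.contMDiff.mdifferentiableAt (by simp)

theorem IsContactomorphism.id (α : OneForm I M) : IsContactomorphism α (fun x : M => x) :=
  ⟨⟨Diffeomorph.refl I M ∞, rfl⟩, fun x v => by
    rw [show (fun x : M => x) = _root_.id from rfl, mfderiv_id]; rfl⟩

theorem IsContactomorphism.comp {α : OneForm I M} {f g : M → M} (hg : IsContactomorphism α g)
    (hf : IsContactomorphism α f) : IsContactomorphism α (fun x => g (f x)) := by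
  refine ⟨?_, fun x v => ?_⟩
  · obtain ⟨⟨F, rfl⟩, -⟩ := hf
    obtain ⟨⟨G, rfl⟩, -⟩ := hg
    exact ⟨F.trans G, rfl⟩
  · have h := mfderiv_comp x (hg.mdifferentiableAt (f x)) (hf.mdifferentiableAt x)
    have h' := congrArg (fun L => L v) h
    exact (iff_of_eq (congrArg (fun u => α (g (f x)) u = 0) h')).trans
      ((hg.2 (f x) _).trans (hf.2 x v))

theorem IsContactomorphism.inverse {α : OneForm I M} {f g : M → M} (hf : IsContactomorphism α f)
    (hfg : ∀ x, f (g x) = x) : IsContactomorphism α g := by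
  obtain ⟨F, hF⟩ := hf.1
  have hg : ⇑F.symm = g := by
    ext x
    rw [← F.symm_apply_apply (g x), hF, hfg]
  refine ⟨⟨F.symm, hg⟩, fun x v => ?_⟩
  have hgd : MDifferentiableAt I I g x := by
    rw [← hg]; exact F.symm.contMDiff.mdifferentiableAt (by simp)
  refine (hf.2 (g x) (mfderiv I I g x v)).symm.trans ?_
  have h := mfderiv_comp x (hf.mdifferentiableAt (g x)) hgd
  have hid : f ∘ g = _root_.id := funext hfg
  rw [hid, mfderiv_id] at h
  have h' := congrArg (fun L => L v) h
  have h'' : mfderiv I I f (g x) (mfderiv I I g x v) = v := h'.symm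
  exact iff_of_eq (congrArg (· = 0) (α.congr_apply (hfg x) h''))

/-- The Hamiltonian of a family of maps parametrised by `ℝ`. -/
def familyHamiltonian (α : OneForm I M) (ψ : ℝ → M → M) (t : ℝ) (x : M) : ℝ :=
  α (ψ t x) (mfderiv 𝓘(ℝ, ℝ) I (fun s => ψ s x) t (1 : ℝ))

/-- A smooth family, with parameter in `ℝ`, of contactomorphisms supported in a common compact
subset of `U`. -/
structure IsContactFamily (α : OneForm I M) (U : Set M) (ψ : ℝ → M → M) : Prop where
  smooth : ContMDiff (𝓘(ℝ, ℝ).prod I) I ∞ (Function.uncurry ψ)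
  contact : ∀ t, IsContactomorphism α (ψ t)
  compactSupport : ∃ K ⊆ U, IsCompact K ∧ ∀ t, ∀ x ∉ K, ψ t x = x

namespace IsContactFamily

variable {α : OneForm I M} {U : Set M} {ψ θ : ℝ → M → M}

theorem mdifferentiableAt_path (hψ : IsContactFamily α U ψ) (t : ℝ) (x : M) :
    MDifferentiableAt 𝓘(ℝ, ℝ) I (fun s => ψ s x) t :=
  (hψ.smooth.comp (contMDiff_id.prodMk contMDiff_const)).mdifferentiableAt (by simp)

theorem comp (hψ : IsContactFamily α U ψ) (hθ : IsContactFamily α U θ) :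
    IsContactFamily α U (fun t x => ψ t (θ t x)) := by
  refine ⟨hψ.smooth.comp (contMDiff_fst.prodMk hθ.smooth),
    fun t => (hψ.contact t).comp (hθ.contact t), ?_⟩
  obtain ⟨K, hKU, hK, h⟩ := hψ.compactSupport
  obtain ⟨K', hKU', hK', h'⟩ := hθ.compactSupport
  refine ⟨K ∪ K', union_subset hKU hKU', hK.union hK', fun t x hx => ?_⟩
  rw [mem_union, not_or] at hx
  simp only [h' t x hx.2, h t x hx.1]

theorem reparam (hψ : IsContactFamily α U ψ) {a : ℝ → ℝ} (ha : ContDiff ℝ ∞ a) :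
    IsContactFamily α U (fun t => ψ (a t)) := by
  refine ⟨hψ.smooth.comp ((ha.contMDiff.comp contMDiff_fst).prodMk contMDiff_snd),
    fun t => hψ.contact _, ?_⟩
  obtain ⟨K, hKU, hK, h⟩ := hψ.compactSupport
  exact ⟨K, hKU, hK, fun t x hx => h _ x hx⟩

theorem const {f : M → M} (hf : IsContactomorphism α f) {K : Set M} (hKU : K ⊆ U)
    (hK : IsCompact K) (h : ∀ x ∉ K, f x = x) : IsContactFamily α U (fun _ => f) := by
  refine ⟨?_, fun _ => hf, K, hKU, hK, fun _ => h⟩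
  obtain ⟨⟨F, rfl⟩, -⟩ := hf
  exact F.contMDiff.comp contMDiff_snd

theorem hamiltonian_reparam (hψ : IsContactFamily α U ψ) {a : ℝ → ℝ} (ha : ContDiff ℝ ∞ a)
    (t : ℝ) (x : M) :
    familyHamiltonian α (fun t => ψ (a t)) t x = deriv a t * familyHamiltonian α ψ (a t) x := by
  have had : HasDerivAt a (deriv a t) t := ((ha.differentiable (by simp)) t).hasDerivAt
  have h := (hψ.mdifferentiableAt_path (a t) x).hasMFDerivAt.comp t had.hasFDerivAt.hasMFDerivAt
  have h1 := congrArg (fun L : ℝ →L[ℝ] E => L 1) h.mfderiv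
  have h2 : ∀ (L : ℝ →L[ℝ] E) (c : ℝ), (L.comp (ContinuousLinearMap.toSpanSingleton ℝ c)) 1 =
      c • L 1 := fun L c => by
    rw [← map_smul]; simp
  refine (congrArg (α (ψ (a t) x)) (h1.trans (h2 _ _))).trans
    (map_smul (α (ψ (a t) x)) _ _)

end IsContactFamily

theorem familyHamiltonian_congr {α : OneForm I M} {ψ θ : ℝ → M → M} {t : ℝ} {x : M}
    (h : (fun s => ψ s x) =ᶠ[𝓝 t] fun s => θ s x) :
    familyHamiltonian α ψ t x = familyHamiltonian α θ t x := by
  have h0 : ψ t x = θ t x := h.self_of_nhds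
  have h1 : (mfderiv 𝓘(ℝ, ℝ) I (fun s => ψ s x) t : ℝ →L[ℝ] E) =
      mfderiv 𝓘(ℝ, ℝ) I (fun s => θ s x) t := h.mfderiv_eq
  exact α.congr_apply h0 (congrArg (fun L : ℝ →L[ℝ] E => L 1) h1)

theorem familyHamiltonian_of_eventuallyEq_const {α : OneForm I M} {ψ : ℝ → M → M} {t : ℝ} {x y : M}
    (h : ∀ᶠ s in 𝓝 t, ψ s x = y) : familyHamiltonian α ψ t x = 0 := by
  rw [familyHamiltonian_congr (θ := fun _ _ => y) h, familyHamiltonian]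
  have h1 : (mfderiv 𝓘(ℝ, ℝ) I (fun _ : ℝ => y) t : ℝ →L[ℝ] E) = 0 := mfderiv_const
  have h2 : (mfderiv 𝓘(ℝ, ℝ) I (fun _ : ℝ => y) t : ℝ →L[ℝ] E) 1 = 0 := by rw [h1]; rfl
  exact (congrArg (α y) h2).trans (map_zero _)

theorem familyHamiltonian_eq_zero_of_fixed {α : OneForm I M} {ψ : ℝ → M → M}
    {K : Set M} (h : ∀ t, ∀ x ∉ K, ψ t x = x) (t : ℝ) {x : M} (hx : x ∉ K) :
    familyHamiltonian α ψ t x = 0 :=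
  familyHamiltonian_of_eventuallyEq_const (y := x) (Filter.Eventually.of_forall fun s => h s x hx)

/-- `f` is the end of a contact isotopy supported in `U`, constant near the ends of the time
interval `[0,1]`, of energy at most `e`. -/
def IsReachable (α : OneForm I M) (U : Set M) (e : ℝ≥0∞) (f : M → M) : Prop :=
  ∃ ψ : ℝ → M → M, IsContactFamily α U ψ ∧ (∀ t ≤ 0, ∀ x, ψ t x = x) ∧ (∀ t ≥ 1, ψ t = f) ∧
    ∃ b : ℝ → ℝ≥0∞, Measurable b ∧ (∀ t x, ENNReal.ofReal |familyHamiltonian α ψ t x| ≤ b t) ∧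
      ∫⁻ t, b t ≤ e

namespace IsReachable

open MeasureTheory

variable {α : OneForm I M} {U : Set M} {e e' : ℝ≥0∞} {f g : M → M}

theorem contact (hf : IsReachable α U e f) : IsContactomorphism α f := by
  obtain ⟨ψ, hψ, -, h1, -⟩ := hf
  rw [← h1 1 le_rfl]
  exact hψ.contact 1

theorem mono (hf : IsReachable α U e f) (h : e ≤ e') : IsReachable α U e' f := by
  obtain ⟨ψ, hψ, h0, h1, b, hb, hH, hbe⟩ := hf
  exact ⟨ψ, hψ, h0, h1, b, hb, hH, hbe.trans h⟩

theorem id (α : OneForm I M) (U : Set M) : IsReachable α U 0 (fun x => x) :=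
  ⟨fun _ x => x, IsContactFamily.const (IsContactomorphism.id α) (empty_subset U) isCompact_empty
    (fun _ _ => rfl), fun _ _ _ => rfl, fun _ _ => rfl, 0, measurable_const, fun t x => by
      rw [familyHamiltonian_of_eventuallyEq_const (y := x) (Filter.Eventually.of_forall fun _ => rfl)]
      simp, by simp⟩

theorem lintegral_comp_two_mul_sub {b : ℝ → ℝ≥0∞} (hb : Measurable b) (c : ℝ) :
    ∫⁻ t, 2 * b (2 * t - c) = ∫⁻ t, b t := by
  have h1 : ∫⁻ t, b (t - c) = ∫⁻ t, b t := lintegral_sub_right_eq_self b c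
  have hm : Measurable fun t => b (t - c) := hb.comp (measurable_id.sub_const c)
  have h2 : ∫⁻ t, b (2 * t - c) = ENNReal.ofReal |(2 : ℝ)⁻¹| * ∫⁻ t, b (t - c) := by
    rw [← lintegral_map (f := fun t => b (t - c)) (g := fun t : ℝ => 2 * t) hm
      (measurable_const_mul 2), Real.map_volume_mul_left two_ne_zero, lintegral_smul_measure,
      smul_eq_mul]
  have hm2 : Measurable fun t => b (2 * t - c) := hb.comp ((measurable_const_mul 2).sub_const c)
  rw [lintegral_const_mul _ hm2, h2, h1, ← mul_assoc]
  have : (2 : ℝ≥0∞) * ENNReal.ofReal |(2 : ℝ)⁻¹| = 1 := by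
    rw [abs_of_pos (by norm_num), ENNReal.ofReal_inv_of_pos two_pos]
    simp [ENNReal.mul_inv_cancel]
  rw [this, one_mul]

/-- Concatenation of isotopies. -/
theorem comp (hf : IsReachable α U e f) (hg : IsReachable α U e' g) :
    IsReachable α U (e + e') (fun x => f (g x)) := by
  obtain ⟨ψ, hψ, hψ0, hψ1, b, hb, hbH, hbe⟩ := hf
  obtain ⟨θ, hθ, hθ0, hθ1, b', hb', hbH', hbe'⟩ := hg
  have ha : ContDiff ℝ ∞ fun t : ℝ => 2 * t - 1 := by fun_prop
  have ha' : ContDiff ℝ ∞ fun t : ℝ => 2 * t - 0 := by fun_prop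
  have hda : ∀ c t : ℝ, deriv (fun t : ℝ => 2 * t - c) t = 2 := fun c t => by
    simp
  refine ⟨fun t x => ψ (2 * t - 1) (θ (2 * t - 0) x), (hψ.reparam ha).comp (hθ.reparam ha'),
    fun t ht x => by simp only [hψ0 (2 * t - 1) (by linarith), hθ0 (2 * t - 0) (by linarith)],
    fun t ht => by
      simp only [hψ1 (2 * t - 1) (by linarith), hθ1 (2 * t - 0) (by linarith)],
    -- The first half of the time interval follows `θ`, the second `ψ`. At the junction `t = 1 / 2`
    -- the bound is `⊤`, which makes it trivial there and costs nothing in the integral.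
    fun t => (2 * b (2 * t - 1) + 2 * b' (2 * t - 0)) + ({1 / 2} : Set ℝ).indicator (fun _ => ⊤) t,
    ?_, fun t x => ?_, ?_⟩
  · have h1 : Measurable fun t : ℝ => 2 * b (2 * t - 1) :=
      (hb.comp ((measurable_const_mul 2).sub_const 1)).const_mul 2
    have h2 : Measurable fun t : ℝ => 2 * b' (2 * t - 0) :=
      (hb'.comp ((measurable_const_mul 2).sub_const 0)).const_mul 2
    exact (h1.add h2).add (measurable_const.indicator (measurableSet_singleton _))
  · have hofReal : ∀ r : ℝ, ENNReal.ofReal |2 * r| = 2 * ENNReal.ofReal |r| := fun r => by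
      rw [abs_mul, ENNReal.ofReal_mul (abs_nonneg _)]; simp
    rcases lt_trichotomy t (1 / 2) with ht | ht | ht
    · have h1 : (fun s => ψ (2 * s - 1) (θ (2 * s - 0) x)) =ᶠ[𝓝 t] fun s => θ (2 * s - 0) x := by
        filter_upwards [eventually_lt_nhds ht] with s hs using hψ0 _ (by linarith) _
      rw [familyHamiltonian_congr (ψ := fun s x => ψ (2 * s - 1) (θ (2 * s - 0) x))
        (θ := fun s x => θ (2 * s - 0) x) h1, hθ.hamiltonian_reparam ha', hda, hofReal]
      exact (mul_le_mul_right (hbH' _ _) 2).trans (le_add_right (le_add_left le_rfl))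
    · simp [ht]
    · have h1 : (fun s => ψ (2 * s - 1) (θ (2 * s - 0) x)) =ᶠ[𝓝 t]
          fun s => ψ (2 * s - 1) (g x) := by
        filter_upwards [eventually_gt_nhds ht] with s hs
        rw [hθ1 _ (by linarith)]
      rw [familyHamiltonian_congr (ψ := fun s x => ψ (2 * s - 1) (θ (2 * s - 0) x))
        (θ := fun s x => ψ (2 * s - 1) (g x)) h1]
      change ENNReal.ofReal |familyHamiltonian α (fun s => ψ (2 * s - 1)) t (g x)| ≤ _
      rw [hψ.hamiltonian_reparam ha, hda, hofReal]
      exact (mul_le_mul_right (hbH _ _) 2).trans (le_add_right (le_add_right le_rfl))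
  · have h1 : Measurable fun t : ℝ => 2 * b (2 * t - 1) :=
      (hb.comp ((measurable_const_mul 2).sub_const 1)).const_mul 2
    have h2 : Measurable fun t : ℝ => 2 * b' (2 * t - 0) :=
      (hb'.comp ((measurable_const_mul 2).sub_const 0)).const_mul 2
    have h12 : Measurable fun t : ℝ => 2 * b (2 * t - 1) + 2 * b' (2 * t - 0) := h1.add h2
    rw [lintegral_add_left h12, lintegral_add_left h1, lintegral_comp_two_mul_sub hb,
      lintegral_comp_two_mul_sub hb', lintegral_indicator_const (measurableSet_singleton _)]
    simpa using add_le_add hbe hbe'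

/-- The inverse of the end of an isotopy is reached with the same energy. -/
theorem inverse (hf : IsReachable α U e f) (hgf : ∀ x, g (f x) = x) (hfg : ∀ x, f (g x) = x) :
    IsReachable α U e g := by
  have hgc := hf.contact.inverse hfg
  obtain ⟨ψ, hψ, hψ0, hψ1, b, hb, hbH, hbe⟩ := hf
  have ha : ContDiff ℝ ∞ fun t : ℝ => 1 - t := by fun_prop
  obtain ⟨K, hKU, hK, hKψ⟩ := hψ.compactSupport
  have hgK : ∀ x ∉ K, g x = x := fun x hx => by
    have : f x = x := by rw [← hψ1 1 le_rfl]; exact hKψ 1 x hx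
    conv_lhs => rw [← this]
    exact hgf x
  -- The reversed path, precomposed with `g`, runs from `f ∘ g = id` to `g`. Precomposition only
  -- changes the point at which the Hamiltonian is evaluated, and reversal changes its sign.
  refine ⟨fun t x => ψ (1 - t) (g x), (hψ.reparam ha).comp (.const hgc hKU hK hgK),
    fun t ht x => by simp only [hψ1 (1 - t) (by linarith), hfg],
    fun t ht => funext fun x => hψ0 (1 - t) (by linarith) _, fun t => b (1 - t),
    hb.comp (measurable_const.sub measurable_id), fun t x => ?_,
    (lintegral_sub_left_eq_self b 1).trans_le hbe⟩
  change ENNReal.ofReal |familyHamiltonian α (fun s => ψ (1 - s)) t (g x)| ≤ _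
  rw [hψ.hamiltonian_reparam ha]
  have : deriv (fun t : ℝ => 1 - t) t = -1 := by
    simp
  rw [this, neg_one_mul, abs_neg]
  exact hbH _ _

end IsReachable

/-! ### Cost of following a family for a given time -/

open MeasureTheory in
theorem lintegral_ofReal_mul_deriv_smoothTransition {c : ℝ} (hc : 0 ≤ c) :
    ∫⁻ t, ENNReal.ofReal (c * deriv Real.smoothTransition t) = ENNReal.ofReal c := by
  set τ := Real.smoothTransition
  have hτ : ContDiff ℝ ∞ τ := Real.smoothTransition.contDiff
  have hcont : Continuous (deriv τ) := hτ.continuous_deriv (by simp)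
  have hnn : ∀ t, 0 ≤ deriv τ t := fun t => Real.smoothTransition.monotone.deriv_nonneg
  have h0 : ∀ t ∉ Ioc (0 : ℝ) 1, deriv τ t = 0 := fun t ht => by
    by_cases h : t ≤ 0
    · have hlt : ∀ s < 0, deriv τ s = 0 := fun s hs => by
        have : τ =ᶠ[𝓝 s] fun _ => 0 := by
          filter_upwards [eventually_lt_nhds hs] with r hr
            using Real.smoothTransition.zero_of_nonpos hr.le
        rw [this.deriv_eq]; simp
      -- The vanishing for negative times extends to time `0` by continuity.
      have hcl : closure (Iio (0 : ℝ)) ⊆ {s | deriv τ s = 0} :=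
        closure_minimal hlt (isClosed_eq hcont continuous_const)
      rw [closure_Iio] at hcl
      exact hcl h
    · have ht1 : 1 < t := by
        by_contra h'
        exact ht ⟨not_le.1 h, not_lt.1 h'⟩
      have : τ =ᶠ[𝓝 t] fun _ => 1 := by
        filter_upwards [eventually_gt_nhds ht1] with r hr
          using Real.smoothTransition.one_of_one_le hr.le
      rw [this.deriv_eq]; simp
  have h1 : ∫⁻ t, ENNReal.ofReal (c * deriv τ t) =
      ∫⁻ t in Ioc (0 : ℝ) 1, ENNReal.ofReal (c * deriv τ t) := by
    rw [← lintegral_indicator measurableSet_Ioc]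
    congr 1
    ext t
    by_cases ht : t ∈ Ioc (0 : ℝ) 1
    · rw [indicator_of_mem ht]
    · rw [indicator_of_notMem ht, h0 t ht]; simp
  rw [h1, ← ofReal_integral_eq_lintegral_ofReal]
  · rw [← intervalIntegral.integral_of_le zero_le_one, intervalIntegral.integral_const_mul,
      intervalIntegral.integral_deriv_eq_sub (fun t _ => (hτ.differentiable (by simp)) t)
        (hcont.intervalIntegrable 0 1)]
    simp [τ]
  · exact ((hcont.const_mul c).integrableOn_Icc (a := 0) (b := 1)).mono_set Ioc_subset_Icc_self
  · exact Filter.Eventually.of_forall fun t => mul_nonneg hc (hnn t)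

/-- Following a contact family from time `0` to time `σ` costs at most `σ` times a bound for its
Hamiltonian. -/
theorem IsContactFamily.isReachable {α : OneForm I M} {U : Set M} {ψ : ℝ → M → M}
    (hψ : IsContactFamily α U ψ) (h0 : ∀ x, ψ 0 x = x) {σ D : ℝ} (hσ : 0 ≤ σ) (hD : 0 ≤ D)
    (hH : ∀ t ∈ Icc 0 σ, ∀ x, |familyHamiltonian α ψ t x| ≤ D) :
    IsReachable α U (ENNReal.ofReal (σ * D)) (ψ σ) := by
  set τ := Real.smoothTransition
  have hτ : ContDiff ℝ ∞ τ := Real.smoothTransition.contDiff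
  have ha : ContDiff ℝ ∞ fun t => σ * τ t := contDiff_const.mul hτ
  -- The smooth step makes the path stationary outside `[0,1]` without extra cost: it is monotone
  -- from `0` to `1`, so its derivative has integral `1`.
  refine ⟨fun t => ψ (σ * τ t), hψ.reparam ha, fun t ht x => ?_, fun t ht => ?_,
    fun t => ENNReal.ofReal (σ * D * deriv τ t), ?_, fun t x => ?_,
    (lintegral_ofReal_mul_deriv_smoothTransition (mul_nonneg hσ hD)).le⟩
  · simp [τ, Real.smoothTransition.zero_of_nonpos ht, h0]
  · simp [τ, Real.smoothTransition.one_of_one_le ht]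
  · exact ((hτ.continuous_deriv (by simp)).measurable.const_mul _).ennreal_ofReal
  · rw [hψ.hamiltonian_reparam ha, deriv_const_mul _ ((hτ.differentiable (by simp)) t)]
    apply ENNReal.ofReal_le_ofReal
    have hnn : 0 ≤ deriv τ t := Real.smoothTransition.monotone.deriv_nonneg
    have hmem : σ * τ t ∈ Icc 0 σ :=
      ⟨mul_nonneg hσ (Real.smoothTransition.nonneg t),
        mul_le_of_le_one_right hσ (Real.smoothTransition.le_one t)⟩
    rw [abs_mul, abs_of_nonneg (mul_nonneg hσ hnn)]
    calc σ * deriv τ t * |familyHamiltonian α ψ (σ * τ t) x|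
        ≤ σ * deriv τ t * D := mul_le_mul_of_nonneg_left (hH _ hmem x) (mul_nonneg hσ hnn)
      _ = σ * D * deriv τ t := by ring

end Reach

/-! ## Rescaling and localisation of contact families on the 1-jet bundle -/

section JetFamilies

variable {n : ℕ} {N : Type*} [TopologicalSpace N] [ChartedSpace (EuclideanSpace ℝ (Fin n)) N]
  [IsManifold (𝓡 n) ∞ N]

theorem isContactomorphism_jetScale {l : ℝ} (hl : l ≠ 0) :
    IsContactomorphism (stdContactForm n N) (jetScale l) := by
  refine ⟨⟨⟨⟨jetScale l, jetScale l⁻¹, fun x => ?_, fun x => ?_⟩, contMDiff_jetScale l,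
    contMDiff_jetScale l⁻¹⟩, rfl⟩, fun x v => ?_⟩
  · rw [jetScale_jetScale, inv_mul_cancel₀ hl, jetScale_one]
  · rw [jetScale_jetScale, mul_inv_cancel₀ hl, jetScale_one]
  · have h := stdContactForm_jetScale_comp (I := jetModel n) l
      (mdifferentiableAt_id (x := x)) v
    have hid : mfderiv (jetModel n) (jetModel n) (id : JetBundle n N → JetBundle n N) x v = v := by
      rw [mfderiv_id]; rfl
    have h' : stdContactForm n N (jetScale l x) (mfderiv (jetModel n) (jetModel n) (jetScale l) x v)
        = l * stdContactForm n N x v :=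
      h.trans (congrArg (fun w => l * stdContactForm n N x w) hid)
    exact (iff_of_eq (congrArg (· = 0) h')).trans (by simp [hl])

theorem IsContactFamily.jetScale_conj {U : Set (JetBundle n N)}
    {ψ : ℝ → JetBundle n N → JetBundle n N} (hψ : IsContactFamily (stdContactForm n N) U ψ)
    {l : ℝ} (hl : l ≠ 0) (hU : ∀ x ∈ U, jetScale l x ∈ U) :
    IsContactFamily (stdContactForm n N) U (fun t x => jetScale l (ψ t (jetScale l⁻¹ x))) := by
  refine ⟨(contMDiff_jetScale l).comp (hψ.smooth.comp (contMDiff_fst.prodMk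
    ((contMDiff_jetScale l⁻¹).comp contMDiff_snd))), fun t => (isContactomorphism_jetScale hl).comp
    ((hψ.contact t).comp (isContactomorphism_jetScale (inv_ne_zero hl))), ?_⟩
  obtain ⟨K, hKU, hK, h⟩ := hψ.compactSupport
  refine ⟨jetScale l '' K, ?_, hK.image (contMDiff_jetScale l).continuous, fun t x hx => ?_⟩
  · rintro _ ⟨x, hx, rfl⟩
    exact hU x (hKU hx)
  · have hx' : jetScale l⁻¹ x ∉ K := fun h' => hx ⟨_, h', by
      rw [jetScale_jetScale, mul_inv_cancel₀ hl, jetScale_one]⟩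
    simp only [h t _ hx', jetScale_jetScale, mul_inv_cancel₀ hl, jetScale_one]

/-- Since the rescaling pulls α back to `l` α, the Hamiltonian of the conjugated path is `l` times
the original one at the point `jetScale l⁻¹ x`. -/
theorem IsReachable.jetScale_conj {U : Set (JetBundle n N)} {e : ℝ≥0∞}
    {f : JetBundle n N → JetBundle n N} (hf : IsReachable (stdContactForm n N) U e f)
    {l : ℝ} (hl : 0 < l) (hU : ∀ x ∈ U, jetScale l x ∈ U) :
    IsReachable (stdContactForm n N) U (ENNReal.ofReal l * e)
      (fun x => jetScale l (f (jetScale l⁻¹ x))) := by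
  obtain ⟨ψ, hψ, h0, h1, b, hb, hbH, hbe⟩ := hf
  refine ⟨_, hψ.jetScale_conj hl.ne' hU, fun t ht x => ?_, fun t ht => ?_,
    fun t => ENNReal.ofReal l * b t, hb.const_mul _, fun t x => ?_, ?_⟩
  · simp only [h0 t ht, jetScale_jetScale, mul_inv_cancel₀ hl.ne', jetScale_one]
  · simp only [h1 t ht]
  · have h : familyHamiltonian (stdContactForm n N) (fun t x => jetScale l (ψ t (jetScale l⁻¹ x)))
        t x = l * familyHamiltonian (stdContactForm n N) ψ t (jetScale l⁻¹ x) :=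
      stdContactForm_jetScale_comp (I := 𝓘(ℝ, ℝ)) l
        (hψ.mdifferentiableAt_path t (jetScale l⁻¹ x)) (1 : ℝ)
    rw [h, abs_mul, abs_of_pos hl, ENNReal.ofReal_mul hl.le]
    exact mul_le_mul_right (hbH _ _) _
  · rw [MeasureTheory.lintegral_const_mul _ hb]
    gcongr

open Classical in
/-- The transport of a map of the model to the 1-jet bundle by a jet chart. -/
def jetConj (q₀ : N) (c : ModelJet (EuclideanSpace ℝ (Fin n)) → ModelJet (EuclideanSpace ℝ (Fin n)))
    (x : JetBundle n N) : JetBundle n N :=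
  if x ∈ (jetChart n q₀).source then (jetChart n q₀).symm (c (jetChart n q₀ x)) else x

theorem jetConj_of_mem {q₀ : N}
    {c : ModelJet (EuclideanSpace ℝ (Fin n)) → ModelJet (EuclideanSpace ℝ (Fin n))}
    {x : JetBundle n N} (hx : x ∈ (jetChart n q₀).source) :
    jetConj q₀ c x = (jetChart n q₀).symm (c (jetChart n q₀ x)) := if_pos hx

theorem jetConj_of_notMem {q₀ : N}
    {c : ModelJet (EuclideanSpace ℝ (Fin n)) → ModelJet (EuclideanSpace ℝ (Fin n))}
    {L : Set (ModelJet (EuclideanSpace ℝ (Fin n)))} (hc : ∀ y ∉ L, c y = y)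
    {x : JetBundle n N} (hx : x ∉ (jetChart n q₀).symm '' L) : jetConj q₀ c x = x := by
  by_cases h : x ∈ (jetChart n q₀).source
  · rw [jetConj_of_mem h, hc, (jetChart n q₀).left_inv h]
    exact fun h' => hx ⟨_, h', (jetChart n q₀).left_inv h⟩
  · exact if_neg h

/-- If `c y ∉ L`, then `c (c y) = c y`, and injectivity gives `c y = y`. -/
theorem mapsTo_of_injective_of_fixed {X : Type*} {c : X → X} (hinj : Function.Injective c)
    {L T : Set X} (hLT : L ⊆ T) (hc : ∀ y ∉ L, c y = y) : ∀ y ∈ T, c y ∈ T := fun y hy => by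
  by_cases h : c y ∈ L
  · exact hLT h
  · rwa [hinj (hc _ h)]

/-! ### Transport of model isotopies through a jet chart -/

section Transport

variable {q₀ : N} {L : Set (ModelJet (EuclideanSpace ℝ (Fin n)))}
  {c c' : ℝ → ModelJet (EuclideanSpace ℝ (Fin n)) → ModelJet (EuclideanSpace ℝ (Fin n))}

theorem isCompact_symm_image (hL : IsCompact L) (hLT : L ⊆ (jetChart n q₀).target) :
    IsCompact ((jetChart n q₀).symm '' L) :=
  hL.image_of_continuousOn ((contMDiffOn_jetChart_symm q₀).continuousOn.mono hLT)

variable [T2Space N]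

/-- The chart domain and the complement of the compact, hence closed, image of `L` form an open
cover; on the latter the map is the identity. -/
theorem contMDiff_jetConj (hL : IsCompact L) (hLT : L ⊆ (jetChart n q₀).target)
    (hc : ContDiff ℝ ∞ (Function.uncurry c)) (hinj : ∀ t, Function.Injective (c t))
    (hfix : ∀ t, ∀ y ∉ L, c t y = y) :
    ContMDiff (𝓘(ℝ, ℝ).prod (jetModel n)) (jetModel n) ∞
      (Function.uncurry fun t => (jetConj q₀ (c t) : JetBundle n N → JetBundle n N)) := by
  have hclosed : IsClosed ((jetChart n q₀).symm '' L) := (isCompact_symm_image hL hLT).isClosed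
  have hmaps := fun t => mapsTo_of_injective_of_fixed (hinj t) hLT (hfix t)
  refine contMDiff_of_contMDiffOn_union_of_isOpen (s := univ ×ˢ (jetChart n q₀).source)
    (t := univ ×ˢ ((jetChart n q₀).symm '' L)ᶜ) ?_ ?_ ?_
    (isOpen_univ.prod (isOpen_jetChart_source q₀)) (isOpen_univ.prod hclosed.isOpen_compl)
  · have h1 : ContMDiffOn (𝓘(ℝ, ℝ).prod (jetModel n))
        𝓘(ℝ, ℝ × ModelJet (EuclideanSpace ℝ (Fin n))) ∞
        (fun p : ℝ × JetBundle n N => (p.1, jetChart n q₀ p.2))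
        (univ ×ˢ (jetChart n q₀).source) := by
      rw [modelWithCornersSelf_prod, ← chartedSpaceSelf_prod]
      exact contMDiff_fst.contMDiffOn.prodMk ((contMDiffOn_jetChart q₀).comp
        contMDiff_snd.contMDiffOn fun p hp => hp.2)
    have h2 := (contMDiffOn_jetChart_symm q₀).comp (hc.contMDiff.comp_contMDiffOn h1)
      fun p hp => hmaps p.1 _ ((jetChart n q₀).map_source hp.2)
    exact h2.congr fun p hp => jetConj_of_mem hp.2
  · exact contMDiff_snd.contMDiffOn.congr fun p hp => jetConj_of_notMem (hfix p.1) hp.2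
  · rw [← prod_union, eq_univ_iff_forall]
    rintro ⟨t, x⟩
    refine ⟨mem_univ _, ?_⟩
    by_cases h : x ∈ (jetChart n q₀).source
    · exact Or.inl h
    · refine Or.inr fun ⟨y, hy, hyx⟩ => h ?_
      change (jetChart n q₀).symm y = x at hyx
      rw [← hyx]
      exact (jetChart n q₀).map_target (hLT hy)

omit [T2Space N] in
theorem jetConj_jetConj (hLT : L ⊆ (jetChart n q₀).target)
    {a b : ModelJet (EuclideanSpace ℝ (Fin n)) → ModelJet (EuclideanSpace ℝ (Fin n))}
    (hinj : Function.Injective b) (hfix : ∀ y ∉ L, b y = y) (hab : ∀ y, a (b y) = y)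
    (x : JetBundle n N) : jetConj q₀ a (jetConj q₀ b x) = x := by
  by_cases h : x ∈ (jetChart n q₀).source
  · have hT := mapsTo_of_injective_of_fixed hinj hLT hfix _ ((jetChart n q₀).map_source h)
    rw [jetConj_of_mem h, jetConj_of_mem ((jetChart n q₀).map_target hT),
      (jetChart n q₀).right_inv hT, hab, (jetChart n q₀).left_inv h]
  · rw [show jetConj q₀ b x = x from if_neg h, show jetConj q₀ a x = x from if_neg h]

theorem isContactFamily_jetConj (hL : IsCompact L) (hLT : L ⊆ (jetChart n q₀).target)
    (hc : ContDiff ℝ ∞ (Function.uncurry c)) (hc' : ContDiff ℝ ∞ (Function.uncurry c'))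
    (hl : ∀ t y, c' t (c t y) = y) (hr : ∀ t y, c t (c' t y) = y)
    (hfix : ∀ t, ∀ y ∉ L, c t y = y)
    (hcontact : ∀ t y v, modelForm (c t y) (fderiv ℝ (c t) y v) = 0 ↔ modelForm y v = 0)
    {U : Set (JetBundle n N)} (hLU : (jetChart n q₀).symm '' L ⊆ U) :
    IsContactFamily (stdContactForm n N) U fun t => jetConj q₀ (c t) := by
  have hinj : ∀ t, Function.Injective (c t) := fun t => Function.LeftInverse.injective (hl t)
  have hinj' : ∀ t, Function.Injective (c' t) := fun t => Function.LeftInverse.injective (hr t)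
  have hfix' : ∀ t, ∀ y ∉ L, c' t y = y := fun t y hy => by
    conv_lhs => rw [← hfix t y hy, hl]
  have hsm := contMDiff_jetConj (q₀ := q₀) hL hLT hc hinj hfix
  have hsm' := contMDiff_jetConj (q₀ := q₀) hL hLT hc' hinj' hfix'
  have hslice : ∀ {g : ℝ → JetBundle n N → JetBundle n N}, ContMDiff (𝓘(ℝ, ℝ).prod (jetModel n))
      (jetModel n) ∞ (Function.uncurry g) → ∀ t, ContMDiff (jetModel n) (jetModel n) ∞ (g t) :=
    fun hg t => hg.comp (contMDiff_const.prodMk contMDiff_id)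
  refine ⟨hsm, fun t => ⟨⟨⟨⟨jetConj q₀ (c t), jetConj q₀ (c' t),
    jetConj_jetConj hLT (hinj t) (hfix t) (hl t), jetConj_jetConj hLT (hinj' t) (hfix' t) (hr t)⟩,
    hslice hsm t, hslice hsm' t⟩, rfl⟩, fun x v => ?_⟩, _, hLU, isCompact_symm_image hL hLT,
    fun t x hx => jetConj_of_notMem (hfix t) hx⟩
  have hmd : MDifferentiableAt (jetModel n) (jetModel n) (jetConj q₀ (c t)) x :=
    (hslice hsm t).mdifferentiableAt (by simp)
  by_cases hx : x ∈ (jetChart n q₀).source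
  · have hmaps := mapsTo_of_injective_of_fixed (hinj t) hLT (hfix t)
    have hchart : ∀ y ∈ (jetChart n q₀).source,
        jetChart n q₀ (jetConj q₀ (c t) y) = c t (jetChart n q₀ y) := fun y hy => by
      rw [jetConj_of_mem hy, (jetChart n q₀).right_inv (hmaps _ ((jetChart n q₀).map_source hy))]
    have hmem : jetConj q₀ (c t) x ∈ (jetChart n q₀).source := by
      rw [jetConj_of_mem hx]
      exact (jetChart n q₀).map_target (hmaps _ ((jetChart n q₀).map_source hx))
    have hct : ContDiff ℝ ∞ (c t) := hc.comp (contDiff_const.prodMk contDiff_id)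
    have hcd := ((hct.differentiable (by simp)) (jetChart n q₀ x)).hasFDerivAt.hasMFDerivAt
    have hcomp := hcd.comp x (mdifferentiableAt_jetChart hx).hasMFDerivAt
    have hev : (fun y => jetChart n q₀ (jetConj q₀ (c t) y)) =ᶠ[𝓝 x] c t ∘ jetChart n q₀ := by
      filter_upwards [(isOpen_jetChart_source q₀).mem_nhds hx] with y hy using hchart y hy
    have hv := congrArg (fun L => L v) (hcomp.congr_of_eventuallyEq hev).mfderiv
    have h1 := stdContactForm_mfderiv hmd hmem v
    rw [hchart x hx] at h1
    have h2 := h1.trans (congrArg (modelForm _) hv)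
    exact (iff_of_eq (congrArg (· = 0) h2)).trans ((hcontact t _ _).trans
      (iff_of_eq (congrArg (· = 0) (stdContactForm_eq_modelForm hx v).symm)))
  · have hxL : x ∉ (jetChart n q₀).symm '' L := fun ⟨y, hy, hyx⟩ => hx (by
      rw [← hyx]; exact (jetChart n q₀).map_target (hLT hy))
    have hev : jetConj q₀ (c t) =ᶠ[𝓝 x] id := by
      filter_upwards [(isCompact_symm_image hL hLT).isClosed.isOpen_compl.mem_nhds hxL] with y hy
        using jetConj_of_notMem (hfix t) hy
    have h1 : mfderiv (jetModel n) (jetModel n) (jetConj q₀ (c t)) x v = v := by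
      rw [hev.mfderiv_eq, mfderiv_id]; rfl
    exact iff_of_eq (congrArg (· = 0) ((stdContactForm n N).congr_apply hev.self_of_nhds h1))

end Transport

end JetFamilies

/-! ## Squeezing a compact set towards the zero section -/

section Squeeze

variable {n : ℕ} {N : Type*} [TopologicalSpace N] [ChartedSpace (EuclideanSpace ℝ (Fin n)) N]
  [IsManifold (𝓡 n) ∞ N]

/-- A contact family supported in `U` which near `K` and for small times preserves `q` and
multiplies `z` by `exp (-t χ(q))`, with initial Hamiltonian at most `χ |z|`. -/
structure IsSqueeze (U K : Set (JetBundle n N)) (χ : N → ℝ)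
    (ψ : ℝ → JetBundle n N → JetBundle n N) : Prop where
  family : IsContactFamily (stdContactForm n N) U ψ
  zero : ∀ x, ψ 0 x = x
  hamiltonian : ∀ x, |familyHamiltonian (stdContactForm n N) ψ 0 x| ≤ χ x.1.proj * |x.2|
  germ : ∀ x ∈ K, ∀ᶠ p : ℝ × JetBundle n N in 𝓝 (0, x),
    (ψ p.1 p.2).1.proj = p.2.1.proj ∧ (ψ p.1 p.2).2 = Real.exp (-(p.1 * χ p.2.1.proj)) * p.2.2

theorem IsSqueeze.id (U K : Set (JetBundle n N)) : IsSqueeze U K 0 (fun _ x => x) where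
  family := IsContactFamily.const (IsContactomorphism.id _) (empty_subset U) isCompact_empty
    fun _ _ => rfl
  zero _ := rfl
  hamiltonian x := by
    rw [familyHamiltonian_of_eventuallyEq_const (y := x) (Filter.Eventually.of_forall fun _ => rfl)]
    simp
  germ x _ := Filter.Eventually.of_forall fun p => by simp

/-- The Hamiltonian of a composite at time `0`. -/
theorem familyHamiltonian_comp_zero {E : Type*} [NormedAddCommGroup E] [NormedSpace ℝ E]
    {H : Type*} [TopologicalSpace H] {I : ModelWithCorners ℝ E H}
    {M : Type*} [TopologicalSpace M] [ChartedSpace H M] {α : OneForm I M} {ψ θ : ℝ → M → M}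
    (hψ : ContMDiff (𝓘(ℝ, ℝ).prod I) I ∞ (Function.uncurry ψ))
    (hθ : ContMDiff (𝓘(ℝ, ℝ).prod I) I ∞ (Function.uncurry θ))
    (hψ0 : ∀ x, ψ 0 x = x) (hθ0 : ∀ x, θ 0 x = x) (x : M) :
    familyHamiltonian α (fun t x => ψ t (θ t x)) 0 x =
      familyHamiltonian α ψ 0 x + familyHamiltonian α θ 0 x := by
  have hu : MDifferentiableAt (𝓘(ℝ, ℝ).prod I) I (Function.uncurry ψ) (0, θ 0 x) :=
    hψ.mdifferentiableAt (by simp)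
  have hpath : MDifferentiableAt 𝓘(ℝ, ℝ) I (fun s => θ s x) 0 :=
    (hθ.comp (contMDiff_id.prodMk contMDiff_const)).mdifferentiableAt (by simp)
  set y := θ 0 x with hy
  -- The derivative of `(t, z) ↦ ψ t z` in the direction `(1, w)` splits into the parts `(1, 0)`,
  -- the velocity of `ψ`, and `(0, w)`, which returns `w` because `ψ 0` is the identity.
  set Lu : ℝ × E →L[ℝ] E := mfderiv (𝓘(ℝ, ℝ).prod I) I (Function.uncurry ψ) (0, y)
  set w : E := mfderiv 𝓘(ℝ, ℝ) I (fun s => θ s x) 0 (1 : ℝ)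
  have h1 : (mfderiv 𝓘(ℝ, ℝ) I (fun t => ψ t (θ t x)) 0 : ℝ →L[ℝ] E) 1 = Lu (1, w) :=
    congrArg (fun L : ℝ →L[ℝ] E => L 1)
      (HasMFDerivAt.comp (g := Function.uncurry ψ) (f := fun s => (s, θ s x)) (0 : ℝ)
        hu.hasMFDerivAt ((hasMFDerivAt_id (I := 𝓘(ℝ, ℝ)) (0 : ℝ)).prodMk hpath.hasMFDerivAt)).mfderiv
  have h2 : (mfderiv 𝓘(ℝ, ℝ) I (fun t => ψ t y) 0 : ℝ →L[ℝ] E) 1 = Lu (1, 0) :=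
    congrArg (fun L : ℝ →L[ℝ] E => L 1)
      (HasMFDerivAt.comp (g := Function.uncurry ψ) (f := fun s => (s, y)) (0 : ℝ)
        hu.hasMFDerivAt ((hasMFDerivAt_id (I := 𝓘(ℝ, ℝ)) (0 : ℝ)).prodMk
          (hasMFDerivAt_const y (0 : ℝ)))).mfderiv
  have h3 : w = Lu (0, w) := by
    have e1 := HasMFDerivAt.comp (g := Function.uncurry ψ) (f := fun z => ((0 : ℝ), z)) y
      hu.hasMFDerivAt ((hasMFDerivAt_const (I := I) (I' := 𝓘(ℝ, ℝ)) (0 : ℝ) y).prodMk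
        (hasMFDerivAt_id y))
    have e2 : Function.uncurry ψ ∘ (fun z => ((0 : ℝ), z)) = _root_.id := funext hψ0
    rw [e2] at e1
    exact congrArg (fun L : E →L[ℝ] E => L w) (hasMFDerivAt_unique (hasMFDerivAt_id y) e1)
  have h4 : Lu (1, w) = Lu (1, 0) + Lu (0, w) := by
    rw [← map_add]
    congr 1
    simp
  have h5 : familyHamiltonian α (fun t x => ψ t (θ t x)) 0 x =
      (α y : E →L[ℝ] ℝ) (Lu (1, 0) + Lu (0, w)) := α.congr_apply (hψ0 y) (h1.trans h4)
  have h6 : familyHamiltonian α ψ 0 y = (α y : E →L[ℝ] ℝ) (Lu (1, 0)) := α.congr_apply (hψ0 y) h2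
  have h7 : familyHamiltonian α θ 0 x = (α y : E →L[ℝ] ℝ) (Lu (0, w)) := α.congr_apply rfl h3
  have hyx : y = x := hθ0 x
  refine h5.trans ((map_add (α y : E →L[ℝ] ℝ) _ _).trans ?_)
  exact (congrArg₂ (· + ·) h6 h7).symm.trans (by rw [hyx])

theorem IsSqueeze.comp {U K : Set (JetBundle n N)} {χ χ' : N → ℝ}
    {ψ θ : ℝ → JetBundle n N → JetBundle n N} (hψ : IsSqueeze U K χ ψ) (hθ : IsSqueeze U K χ' θ) :
    IsSqueeze U K (χ + χ') (fun t x => ψ t (θ t x)) where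
  family := hψ.family.comp hθ.family
  zero x := by simp only [hψ.zero, hθ.zero]
  hamiltonian x := by
    rw [familyHamiltonian_comp_zero hψ.family.smooth hθ.family.smooth hψ.zero hθ.zero, Pi.add_apply,
      add_mul]
    exact (abs_add_le _ _).trans (add_le_add (hψ.hamiltonian x) (hθ.hamiltonian x))
  germ x hx := by
    have ht : Filter.Tendsto (fun p : ℝ × JetBundle n N => (p.1, θ p.1 p.2)) (𝓝 (0, x))
        (𝓝 (0, x)) := by
      have := (continuous_fst.prodMk hθ.family.smooth.continuous).tendsto ((0 : ℝ), x)
      simpa [Function.uncurry, hθ.zero] using this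
    filter_upwards [hθ.germ x hx, ht.eventually (hψ.germ x hx)] with p h1 h2
    refine ⟨h2.1.trans h1.1, ?_⟩
    rw [h2.2, h1.2, h1.1, ← mul_assoc, ← Real.exp_add, Pi.add_apply]
    ring_nf

open Classical in
-- The generating function z (1 - e^{-tχ(q)}) β serves both requirements. Where β = 1 it is
-- independent of P and lowers z to e^{-tχ(q)} z; its time derivative at `0` is z χ β, of absolute
-- value at most χ |z|.
theorem exists_isSqueeze_chart [T2Space N] {U K : Set (JetBundle n N)} (hU : IsOpen U)
    (hK : IsCompact K) (hKU : K ⊆ U) {q₀ : N} {χ : N → ℝ}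
    (hχ : ContMDiff (𝓡 n) 𝓘(ℝ, ℝ) ∞ χ) (hχ0 : ∀ q, 0 ≤ χ q)
    (hχs : tsupport χ ⊆ (chartAt (EuclideanSpace ℝ (Fin n)) q₀).source) :
    ∃ ψ, IsSqueeze U K χ ψ := by
  set Φ := jetChart n q₀
  -- Only points of `K` over the support of `χ` matter, since near the others `χ`, and with it the
  -- generating function, vanishes. They form a compact set inside the chart domain.
  set K₁ := K ∩ {x | x.1.proj ∈ tsupport χ}
  have hproj : Continuous fun x : JetBundle n N => x.1.proj :=
    (FiberBundle.continuous_proj _ _).comp continuous_fst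
  have hK₁ : IsCompact K₁ := hK.inter_right ((isClosed_tsupport χ).preimage hproj)
  have hK₁s : K₁ ⊆ Φ.source := fun x hx => by
    rw [jetChart_source]; exact hχs hx.2
  have hC : IsCompact (Φ '' K₁) :=
    hK₁.image_of_continuousOn ((contMDiffOn_jetChart q₀).continuousOn.mono hK₁s)
  have hΩ : IsOpen (Φ.target ∩ Φ.symm ⁻¹' U) :=
    (contMDiffOn_jetChart_symm q₀).continuousOn.isOpen_inter_preimage (isOpen_jetChart_target q₀) hU
  have hCΩ : Φ '' K₁ ⊆ Φ.target ∩ Φ.symm ⁻¹' U := by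
    rintro _ ⟨x, hx, rfl⟩
    refine ⟨Φ.map_source (hK₁s hx), ?_⟩
    rw [mem_preimage, Φ.left_inv (hK₁s hx)]
    exact hKU hx.1
  -- The cut-off `β` will be `1` on `L'` and `0` off `L`, so that the generating function is
  -- independent of P in a neighbourhood of the image of `K₁`, not merely on it.
  obtain ⟨L, hL, hCL, hLΩ⟩ := exists_compact_between hC hΩ hCΩ
  obtain ⟨L', hL', hCL', hL'L⟩ := exists_compact_between hC isOpen_interior hCL
  obtain ⟨β, hβ, hβr, hβs, hβ1⟩ := exists_contMDiff_support_eq_eq_one_iff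
    𝓘(ℝ, ModelJet (EuclideanSpace ℝ (Fin n))) (n := (⊤ : ℕ∞)) (isOpen_interior (s := L))
    hL'.isClosed hL'L
  have hLT : L ⊆ Φ.target := fun y hy => (hLΩ hy).1
  have hβ0 : ∀ y ∉ L, β y = 0 := fun y hy => by
    by_contra h
    have : y ∈ Function.support β := h
    rw [hβs] at this
    exact hy (interior_subset this)
  set h : ℝ → ModelJet (EuclideanSpace ℝ (Fin n)) → ℝ := fun t y =>
    y.2 * (1 - Real.exp (-(t * χ (Φ.symm y).1.proj))) * β y with hdef
  have hh : ContDiff ℝ ∞ (Function.uncurry h) := by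
    rw [contDiff_iff_contDiffAt]
    rintro ⟨t, y⟩
    -- The factor with `χ` is known to be smooth only on the chart target; off `L` the product
    -- vanishes because of `β`.
    by_cases hy : y ∈ L
    · have hχy : ContDiffAt ℝ ∞ (fun y => χ (Φ.symm y).1.proj) y := by
        rw [← contMDiffAt_iff_contDiffAt]
        have h1 : ContMDiffAt 𝓘(ℝ, ModelJet (EuclideanSpace ℝ (Fin n))) (jetModel n) ∞ Φ.symm y :=
          (contMDiffOn_jetChart_symm q₀).contMDiffAt ((isOpen_jetChart_target q₀).mem_nhds (hLT hy))
        have h2 : ContMDiff (jetModel n) (𝓡 n) ∞ (fun y : JetBundle n N => y.1.proj) :=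
          (Bundle.contMDiff_proj (fun q : N => CotangentSpace n q)).comp contMDiff_fst
        exact (hχ.comp h2).contMDiffAt.comp y h1
      have hχp : ContDiffAt ℝ ∞ (fun p : ℝ × ModelJet (EuclideanSpace ℝ (Fin n)) =>
          χ (Φ.symm p.2).1.proj) (t, y) :=
        ContDiffAt.comp (g := fun y => χ (Φ.symm y).1.proj) (t, y) hχy contDiffAt_snd
      have hβp : ContDiffAt ℝ ∞ (fun p : ℝ × ModelJet (EuclideanSpace ℝ (Fin n)) => β p.2) (t, y) :=
        (hβ.contDiff.comp contDiff_snd).contDiffAt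
      exact ((contDiff_snd.comp contDiff_snd).contDiffAt.mul (contDiffAt_const.sub
        (Real.contDiff_exp.contDiffAt.comp (t, y) (contDiffAt_fst.mul hχp).neg))).mul hβp
    · refine (contDiffAt_const (c := (0 : ℝ))).congr_of_eventuallyEq ?_
      filter_upwards [(continuous_snd.tendsto (t, y)).eventually
        (hL.isClosed.isOpen_compl.mem_nhds hy)] with p hp
      simp [Function.uncurry, hdef, hβ0 p.2 hp]
  have hsupp : ∀ t, ∀ y ∉ L, h t y = 0 := fun t y hy => by simp [hdef, hβ0 y hy]
  obtain ⟨c, c', hc, hc', hl, hr, hc0, hfix, hcontact, hham, hgerm⟩ :=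
    exists_modelIsotopy hh (fun x => by simp [hdef]) hL hsupp
  have hinj : ∀ t, Function.Injective (c t) := fun t => Function.LeftInverse.injective (hl t)
  have hmaps := fun t => mapsTo_of_injective_of_fixed (hinj t) hLT (hfix t)
  have hLU : Φ.symm '' L ⊆ U := by
    rintro _ ⟨y, hy, rfl⟩
    exact (hLΩ hy).2
  have hfam := isContactFamily_jetConj hL hLT hc hc' hl hr hfix hcontact hLU
  have hchart : ∀ t, ∀ x ∈ Φ.source, Φ (jetConj q₀ (c t) x) = c t (Φ x) := fun t x hx => by
    rw [jetConj_of_mem hx, Φ.right_inv (hmaps t _ (Φ.map_source hx))]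
  have hsrc : ∀ t, ∀ x ∈ Φ.source, jetConj q₀ (c t) x ∈ Φ.source := fun t x hx => by
    rw [jetConj_of_mem hx]
    exact Φ.map_target (hmaps t _ (Φ.map_source hx))
  have hzero : ∀ x, jetConj q₀ (c 0) x = x := fun x => by
    by_cases hx : x ∈ Φ.source
    · rw [jetConj_of_mem hx, hc0, Φ.left_inv hx]
    · exact if_neg hx
  refine ⟨_, hfam, hzero, fun x => ?_, fun x hxK => ?_⟩
  · by_cases hx : x ∈ Φ.source
    · have h1 := stdContactForm_velocity (hfam.mdifferentiableAt_path 0 x) (hsrc 0 x hx)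
      have h2 : familyHamiltonian (stdContactForm n N) (fun t => jetConj q₀ (c t)) 0 x =
          deriv (fun t => h t (Φ x)) 0 := by
        refine h1.trans ?_
        rw [← hham, hzero]
        congr 2
        exact funext fun t => hchart t x hx
      have h3 : HasDerivAt (fun t => h t (Φ x)) (x.2 * χ x.1.proj * β (Φ x)) 0 := by
        have e1 : HasDerivAt (fun t : ℝ => -(t * χ x.1.proj)) (-(1 * χ x.1.proj)) 0 :=
          ((hasDerivAt_id (0 : ℝ)).mul_const _).neg
        have e2 := ((e1.exp.const_sub 1).const_mul x.2).mul_const (β (Φ x))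
        have e3 : (fun t => h t (Φ x)) =
            fun t => x.2 * (1 - Real.exp (-(t * χ x.1.proj))) * β (Φ x) := funext fun t => by
          change (Φ x).2 * (1 - Real.exp (-(t * χ (Φ.symm (Φ x)).1.proj))) * β (Φ x) = _
          rw [Φ.left_inv hx]
          rfl
        rw [e3]
        exact e2.congr_deriv (by simp)
      rw [h2, h3.deriv, abs_mul, abs_mul, abs_of_nonneg (hχ0 _), mul_comm |x.2|]
      refine mul_le_of_le_one_right (mul_nonneg (hχ0 _) (abs_nonneg _)) ?_
      obtain ⟨hb0, hb1⟩ := hβr (mem_range_self (Φ x))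
      rwa [abs_of_nonneg hb0]
    · have h1 : familyHamiltonian (stdContactForm n N) (fun t => jetConj q₀ (c t)) 0 x = 0 :=
        familyHamiltonian_of_eventuallyEq_const (y := x)
          (Filter.Eventually.of_forall fun t => if_neg hx)
      simpa [h1] using mul_nonneg (hχ0 _) (abs_nonneg _)
  · by_cases hx : x ∈ Φ.source
    · have hsymm : Filter.Tendsto Φ.symm (𝓝 (Φ x)) (𝓝 x) := by
        have := (contMDiffOn_jetChart_symm q₀).continuousOn.continuousAt
          ((isOpen_jetChart_target q₀).mem_nhds (Φ.map_source hx))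
        rwa [ContinuousAt, Φ.left_inv hx] at this
      have hk : ∀ᶠ w in 𝓝 (Φ x), ∀ t, h t w =
          w.2 * (1 - Real.exp (-(t * χ ((extChartAt (𝓡 n) q₀).symm w.1.1)))) := by
        have hbase : ∀ w ∈ Φ.target, (extChartAt (𝓡 n) q₀).symm w.1.1 = (Φ.symm w).1.proj := by
          intro w hw
          have hw' := Φ.map_target hw
          rw [jetChart_source] at hw'
          conv_lhs => rw [← Φ.right_inv hw]
          exact (extChartAt (𝓡 n) q₀).left_inv (by rwa [extChartAt_source])
        have htgt := (isOpen_jetChart_target q₀).mem_nhds (Φ.map_source hx)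
        by_cases hxs : x.1.proj ∈ tsupport χ
        · filter_upwards [htgt, isOpen_interior.mem_nhds (hCL' ⟨x, ⟨hxK, hxs⟩, rfl⟩)]
            with w hw hwL t
          simp only [hdef, hbase w hw, (hβ1 w).1 (interior_subset hwL), mul_one]
        · have hz : ∀ᶠ x' in 𝓝 x, χ x'.1.proj = 0 :=
            (hproj.tendsto x).eventually (notMem_tsupport_iff_eventuallyEq.1 hxs)
          filter_upwards [htgt, hsymm.eventually hz] with w hw hwz t
          simp only [hdef, hbase w hw, hwz]
          simp
      have htend : Filter.Tendsto (fun p : ℝ × JetBundle n N => (p.1, Φ p.2)) (𝓝 (0, x))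
          (𝓝 (0, Φ x)) := by
        exact continuousAt_fst.prodMk (ContinuousAt.comp (g := Φ) (f := Prod.snd) (x := ((0 : ℝ), x))
          ((contMDiffOn_jetChart q₀).continuousOn.continuousAt
            ((isOpen_jetChart_source q₀).mem_nhds hx)) continuousAt_snd)
      filter_upwards [htend.eventually (hgerm
        (fun t q z => z * (1 - Real.exp (-(t * χ ((extChartAt (𝓡 n) q₀).symm q))))) (Φ x) hk), (continuous_snd.tendsto
        ((0 : ℝ), x)).eventually ((isOpen_jetChart_source q₀).mem_nhds hx)] with p hp hps
      obtain ⟨t, y⟩ := p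
      have e1 := hsrc t y hps
      have e2 := hchart t y hps
      have hys := hps
      rw [jetChart_source] at e1 hys
      have hq : (extChartAt (𝓡 n) q₀) (jetConj q₀ (c t) y).1.proj =
          (extChartAt (𝓡 n) q₀) y.1.proj := by
        have := hp.1
        rw [← e2] at this
        exact this
      refine ⟨(extChartAt (𝓡 n) q₀).injOn (by rwa [extChartAt_source])
        (by rwa [extChartAt_source]) hq, ?_⟩
      have hz := hp.2
      rw [← e2, jetChart_fst_fst, (extChartAt (𝓡 n) q₀).left_inv (by rwa [extChartAt_source])] at hz
      change (jetConj q₀ (c t) y).2 = y.2 - y.2 * (1 - Real.exp (-(t * χ y.1.proj))) at hz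
      change (jetConj q₀ (c t) y).2 = Real.exp (-(t * χ y.1.proj)) * y.2
      rw [hz]
      ring
    · have hxL : x ∉ Φ.symm '' L := fun ⟨y, hy, hyx⟩ => hx (by
        rw [← hyx]; exact Φ.map_target (hLT hy))
      have hxs : x.1.proj ∉ tsupport χ := fun h' => hx (by
        rw [jetChart_source]; exact hχs h')
      have hz : ∀ᶠ x' in 𝓝 x, χ x'.1.proj = 0 :=
        (hproj.tendsto x).eventually (notMem_tsupport_iff_eventuallyEq.1 hxs)
      filter_upwards [(continuous_snd.tendsto ((0 : ℝ), x)).eventually hz,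
        (continuous_snd.tendsto ((0 : ℝ), x)).eventually
          ((isCompact_symm_image hL hLT).isClosed.isOpen_compl.mem_nhds hxL)] with p hp hpL
      have hp' : χ p.2.1.proj = 0 := hp
      have : jetConj q₀ (c p.1) p.2 = p.2 := jetConj_of_notMem (hfix p.1) hpL
      simp only [this, hp']
      simp

end Squeeze

/-! ### Patching squeezes by a partition of unity; rescaling on the compact set -/

section SqueezeGlobal

variable {n : ℕ} {N : Type*} [TopologicalSpace N] [ChartedSpace (EuclideanSpace ℝ (Fin n)) N]
  [IsManifold (𝓡 n) ∞ N]

theorem continuous_jetBundle_proj : Continuous fun x : JetBundle n N => x.1.proj :=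
  (FiberBundle.continuous_proj _ _).comp continuous_fst

/-- Only finitely many members of a partition of unity have closed support meeting the projection of
`K`. Composing their chartwise squeezes adds the exponents, and the partial sum is at most `1`
everywhere and equal to `1` near that projection. -/
theorem exists_isSqueeze [T2Space N] [SecondCountableTopology N] {U K : Set (JetBundle n N)}
    (hU : IsOpen U) (hK : IsCompact K) (hKU : K ⊆ U) :
    ∃ (χ : N → ℝ) (ψ : ℝ → JetBundle n N → JetBundle n N), IsSqueeze U K χ ψ ∧ (∀ q, χ q ≤ 1) ∧
      ∀ x ∈ K, ∀ᶠ q in 𝓝 x.1.proj, χ q = 1 := by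
  have : LocallyCompactSpace N := ChartedSpace.locallyCompactSpace (EuclideanSpace ℝ (Fin n)) N
  have : SigmaCompactSpace N := sigmaCompactSpace_of_locallyCompact_secondCountable
  obtain ⟨f, hf⟩ := SmoothPartitionOfUnity.exists_isSubordinate_chartAt_source (𝓡 n) N
  have hKp : IsCompact ((fun x : JetBundle n N => x.1.proj) '' K) :=
    hK.image continuous_jetBundle_proj
  have hfin := f.locallyFinite.closure.finite_nonempty_inter_compact hKp
  have hex : ∀ s : Finset N, ∃ ψ, IsSqueeze U K (∑ i ∈ s, ⇑(f i)) ψ := fun s => by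
    classical
    induction s using Finset.induction_on with
    | empty => exact ⟨_, by simpa using IsSqueeze.id U K⟩
    | insert i s hi ih =>
      obtain ⟨ψ, hψ⟩ := ih
      obtain ⟨θ, hθ⟩ := exists_isSqueeze_chart hU hK hKU (f i).contMDiff (fun q => f.nonneg i q)
        (hf i)
      rw [Finset.sum_insert hi]
      exact ⟨_, hθ.comp hψ⟩
  obtain ⟨ψ, hψ⟩ := hex hfin.toFinset
  refine ⟨_, ψ, hψ, fun q => ?_, fun x hx => ?_⟩
  · classical
    rw [Finset.sum_apply]
    have h1 : ∑ᶠ i, f i q = ∑ i ∈ hfin.toFinset ∪ f.finsupport q, f i q := by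
      refine finsum_eq_sum_of_support_subset _ fun i hi => ?_
      rw [Finset.coe_union]
      exact Or.inr ((f.mem_finsupport q).2 hi)
    calc ∑ i ∈ hfin.toFinset, f i q ≤ ∑ i ∈ hfin.toFinset ∪ f.finsupport q, f i q :=
          Finset.sum_le_sum_of_subset_of_nonneg Finset.subset_union_left fun i _ _ => f.nonneg i q
      _ ≤ 1 := h1 ▸ f.sum_le_one q
  · filter_upwards [f.eventually_fintsupport_subset x.1.proj] with q hq
    rw [Finset.sum_apply, ← f.sum_eq_one (mem_univ q)]
    refine (finsum_eq_sum_of_support_subset _ fun i hi => ?_).symm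
    have h1 : i ∈ f.fintsupport q := (f.mem_fintsupport_iff q i).2 (subset_closure hi)
    have h2 := (f.mem_fintsupport_iff _ i).1 (hq h1)
    rw [Finset.mem_coe, Finite.mem_toFinset]
    exact ⟨x.1.proj, h2, x, hx, rfl⟩

/-- A contactomorphism that near `x` preserves `q` and multiplies `z` by `l` is at `x` the
rescaling by `l`. -/
theorem IsContactomorphism.eq_jetScale {f : JetBundle n N → JetBundle n N}
    (hf : IsContactomorphism (stdContactForm n N) f) {x : JetBundle n N} {l : ℝ}
    (h : ∀ᶠ y in 𝓝 x, (f y).1.proj = y.1.proj ∧ (f y).2 = l * y.2) : f x = jetScale l x := by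
  have hJ : IsManifold (jetModel n) 1 (JetBundle n N) := IsManifold.of_le (n := ∞) (by simp)
  set Φ := jetChart n x.1.proj with hΦ
  have hx : x ∈ Φ.source := by rw [jetChart_source]; exact mem_chart_source _ _
  have hfx : f x ∈ Φ.source := by
    rw [jetChart_source] at hx ⊢
    rw [mem_ofPred_eq, h.self_of_nhds.1]
    exact hx
  have hlx : jetScale l x ∈ Φ.source := by rw [jetChart_source] at hx ⊢; exact hx
  apply Φ.injOn hfx hlx
  rw [hΦ, jetChart_jetScale, ← hΦ]
  set L := mfderiv (jetModel n) 𝓘(ℝ, ModelJet (EuclideanSpace ℝ (Fin n))) Φ x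
  set L' := mfderiv (jetModel n) 𝓘(ℝ, ModelJet (EuclideanSpace ℝ (Fin n))) (fun y => Φ (f y)) x
  have hL := (mdifferentiableAt_jetChart hx).hasMFDerivAt
  have hL' : HasMFDerivAt (jetModel n) 𝓘(ℝ, ModelJet (EuclideanSpace ℝ (Fin n)))
      (fun y => Φ (f y)) x L' :=
    ((mdifferentiableAt_jetChart hfx).comp x (hf.mdifferentiableAt x)).hasMFDerivAt
  have hq : ∀ v, (L' v).1.1 = (L v).1.1 := fun v => by
    have e1 := (((ContinuousLinearMap.fst ℝ (EuclideanSpace ℝ (Fin n)) _).comp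
      (ContinuousLinearMap.fst ℝ _ ℝ)).hasMFDerivAt (x := Φ (f x))).comp x hL'
    have e2 := (((ContinuousLinearMap.fst ℝ (EuclideanSpace ℝ (Fin n)) _).comp
      (ContinuousLinearMap.fst ℝ _ ℝ)).hasMFDerivAt (x := Φ x)).comp x hL
    refine congrArg (fun L => L v) (hasMFDerivAt_unique e1 (e2.congr_of_eventuallyEq ?_))
    filter_upwards [h] with y hy
    change (Φ (f y)).1.1 = (Φ y).1.1
    rw [hΦ, jetChart_fst_fst, jetChart_fst_fst, hy.1]
  have hz : ∀ v, (L' v).2 = l * (L v).2 := fun v => by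
    have e1 := ((ContinuousLinearMap.snd ℝ (EuclideanSpace ℝ (Fin n) ×
      (EuclideanSpace ℝ (Fin n) →L[ℝ] ℝ)) ℝ).hasMFDerivAt (x := Φ (f x))).comp x hL'
    have e2 := ((l • ContinuousLinearMap.snd ℝ (EuclideanSpace ℝ (Fin n) ×
      (EuclideanSpace ℝ (Fin n) →L[ℝ] ℝ)) ℝ).hasMFDerivAt (x := Φ x)).comp x hL
    refine congrArg (fun L => L v) (hasMFDerivAt_unique e1 (e2.congr_of_eventuallyEq ?_))
    filter_upwards [h] with y hy
    change (Φ (f y)).2 = l * (Φ y).2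
    rw [hΦ, jetChart_snd, jetChart_snd, hy.2]
  have hinv : L.IsInvertible := by
    refine isInvertible_mfderiv_extChartAt ?_
    exact hx
  have hp : (Φ (f x)).1.2 = l • (Φ x).1.2 := by
    ext w
    -- The vector with components (w, 0, p(w)) lies in the contact plane. Its image has base
    -- component w and z-component l p(w), so it lies in the contact plane only if the new covector
    -- takes the value l p(w) on w.
    obtain ⟨v, hv⟩ : ∃ v, L v = ((w, 0), (Φ x).1.2 w) := by
      obtain ⟨A, hA⟩ := hinv
      refine ⟨A.symm ((w, 0), (Φ x).1.2 w), ?_⟩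
      rw [← hA]
      exact A.apply_symm_apply _
    have h0 : stdContactForm n N x v = 0 := by
      refine (stdContactForm_eq_modelForm hx v).trans ((congrArg (modelForm _) hv).trans ?_)
      exact sub_self ((Φ x).1.2 w)
    have h1 := (hf.2 x v).2 h0
    have h2 : modelForm (Φ (f x)) (L' v) = 0 :=
      (stdContactForm_mfderiv (hf.mdifferentiableAt x) hfx v).symm.trans h1
    have h3 : (Φ (f x)).1.2 (L' v).1.1 - (L' v).2 = 0 := h2
    rw [hq, hz, hv, sub_eq_zero] at h3
    exact h3
  refine Prod.ext (Prod.ext ?_ hp) ?_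
  · change (Φ (f x)).1.1 = (Φ x).1.1
    rw [hΦ, jetChart_fst_fst, jetChart_fst_fst, h.self_of_nhds.1]
  · change (Φ (f x)).2 = l * (Φ x).2
    rw [hΦ, jetChart_snd, jetChart_snd, h.self_of_nhds.2]

/-- Near `K` the factor on `z` is e^{-t}. This holds on a neighbourhood of each nearby point, as
`IsContactomorphism.eq_jetScale` requires, and compactness of `K` makes the time bound uniform. -/
theorem IsSqueeze.eventually_eq_jetScale {U K : Set (JetBundle n N)} {χ : N → ℝ}
    {ψ : ℝ → JetBundle n N → JetBundle n N} (hψ : IsSqueeze U K χ ψ) (hK : IsCompact K)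
    (hχ : ∀ x ∈ K, ∀ᶠ q in 𝓝 x.1.proj, χ q = 1) :
    ∀ᶠ t in 𝓝 (0 : ℝ), ∀ x ∈ K, ψ t x = jetScale (Real.exp (-t)) x := by
  refine hK.eventually_forall_of_forall_eventually
    (P := fun t x => ψ t x = jetScale (Real.exp (-t)) x) fun x hx => ?_
  have h1 : ∀ᶠ p : ℝ × JetBundle n N in 𝓝 (0, x), χ p.2.1.proj = 1 :=
    ((continuous_jetBundle_proj.comp continuous_snd).tendsto ((0 : ℝ), x)).eventually (hχ x hx)
  filter_upwards [((hψ.germ x hx).and h1).eventually_nhds] with p hp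
  obtain ⟨t, y⟩ := p
  apply (hψ.family.contact t).eq_jetScale
  have hc : Filter.Tendsto (fun y' : JetBundle n N => (t, y')) (𝓝 y) (𝓝 (t, y)) :=
    (Continuous.prodMk_right t).tendsto y
  filter_upwards [hc.eventually hp] with y' hy'
  obtain ⟨⟨h2, h3⟩, h4⟩ := hy'
  refine ⟨h2, ?_⟩
  have h3' : (ψ t y').2 = Real.exp (-(t * χ y'.1.proj)) * y'.2 := h3
  have h4' : χ y'.1.proj = 1 := h4
  rw [h3', h4', mul_one]

/-- Near time `0` the Hamiltonian of a family is bounded by a constant below `δ` if its initial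
Hamiltonian is at most `|z|` and `|z| < δ` on `U`. -/
theorem IsContactFamily.exists_hamiltonian_bound {U : Set (JetBundle n N)}
    {ψ : ℝ → JetBundle n N → JetBundle n N} (hψ : IsContactFamily (stdContactForm n N) U ψ)
    (hH : ∀ x, |familyHamiltonian (stdContactForm n N) ψ 0 x| ≤ |x.2|)
    {δ : ℝ} (hδ : 0 < δ) (hU : ∀ x ∈ U, |x.2| < δ) :
    ∃ D, 0 ≤ D ∧ D < δ ∧
      ∀ᶠ t in 𝓝 (0 : ℝ), ∀ x, |familyHamiltonian (stdContactForm n N) ψ t x| ≤ D := by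
  obtain ⟨L, hLU, hL, hfix⟩ := hψ.compactSupport
  obtain ⟨D₀, hD₀, hD₀δ, hLD⟩ : ∃ D₀, 0 ≤ D₀ ∧ D₀ < δ ∧ ∀ x ∈ L, |x.2| ≤ D₀ := by
    rcases L.eq_empty_or_nonempty with rfl | hne
    · exact ⟨0, le_rfl, hδ, fun x hx => hx.elim⟩
    · obtain ⟨x₀, hx₀, hmax⟩ := hL.exists_isMaxOn hne
        (f := fun x : JetBundle n N => |x.2|) continuous_snd.abs.continuousOn
      exact ⟨|x₀.2|, abs_nonneg _, hU x₀ (hLU hx₀), fun x hx => hmax hx⟩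
  -- The support is compact in `U`, so its bound `D₀` for `|z|` is strictly below `δ`; the gap
  -- leaves room for the Hamiltonian to vary over a short time.
  obtain ⟨D, hD1, hD2⟩ := exists_between hD₀δ
  refine ⟨D, hD₀.trans hD1.le, hD2, ?_⟩
  have hcont := continuous_stdContactForm_velocity hψ.smooth
  have hloc : ∀ x ∈ L, ∀ᶠ p : ℝ × JetBundle n N in 𝓝 (0, x),
      |familyHamiltonian (stdContactForm n N) ψ p.1 p.2| < D := fun x hx =>
    hcont.abs.continuousAt.eventually_lt continuousAt_const
      (((hH x).trans (hLD x hx)).trans_lt hD1)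
  filter_upwards [hL.eventually_forall_of_forall_eventually
    (P := fun t x => |familyHamiltonian (stdContactForm n N) ψ t x| < D) hloc] with t ht x
  by_cases hx : x ∈ L
  · exact (ht x hx).le
  · rw [familyHamiltonian_eq_zero_of_fixed hfix t hx, abs_zero]
    exact hD₀.trans hD1.le

/-- The Hamiltonian of a compactly supported family is bounded on compact time intervals. -/
theorem IsContactFamily.exists_bound {U : Set (JetBundle n N)}
    {ψ : ℝ → JetBundle n N → JetBundle n N} (hψ : IsContactFamily (stdContactForm n N) U ψ) :
    ∃ D, 0 ≤ D ∧ ∀ t ∈ Icc (0 : ℝ) 1, ∀ x,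
      |familyHamiltonian (stdContactForm n N) ψ t x| ≤ D := by
  obtain ⟨L, -, hL, hfix⟩ := hψ.compactSupport
  obtain ⟨D, hD⟩ := ((isCompact_Icc (a := (0 : ℝ)) (b := 1)).prod hL).exists_bound_of_continuousOn
    (continuous_stdContactForm_velocity hψ.smooth).continuousOn
  refine ⟨max D 0, le_max_right _ _, fun t ht x => ?_⟩
  by_cases hx : x ∈ L
  · exact (hD (t, x) ⟨ht, hx⟩).trans (le_max_left _ _)
  · rw [familyHamiltonian_eq_zero_of_fixed hfix t hx, abs_zero]
    exact le_max_right _ _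

end SqueezeGlobal

/-! ## Passing between an open submanifold and the ambient manifold -/

section OpenSubmanifold

variable {E : Type*} [NormedAddCommGroup E] [NormedSpace ℝ E]
  {H : Type*} [TopologicalSpace H] {I : ModelWithCorners ℝ E H}
  {M : Type*} [TopologicalSpace M] [ChartedSpace H M]
  {E' : Type*} [NormedAddCommGroup E'] [NormedSpace ℝ E']
  {H' : Type*} [TopologicalSpace H'] {I' : ModelWithCorners ℝ E' H'}
  {P : Type*} [TopologicalSpace P] [ChartedSpace H' P]

namespace TopologicalSpace.Opens

variable (U : Opens M)

open Classical in
/-- A retraction of `M` onto the open set `U`, with all points outside `U` sent to `x₀`. -/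
def retractAt (x₀ : U) (y : M) : U := if h : y ∈ U then ⟨y, h⟩ else x₀

variable {U}

theorem retractAt_of_mem (x₀ : U) {y : M} (h : y ∈ U) : U.retractAt x₀ y = ⟨y, h⟩ := dif_pos h

theorem contMDiffAt_retractAt (x₀ : U) : ContMDiffAt I I ∞ (U.retractAt x₀) (x₀ : M) := by
  rw [← ContMDiffAt.subtypeVal_comp_iff]
  refine contMDiffAt_id.congr_of_eventuallyEq ?_
  filter_upwards [U.isOpen.mem_nhds x₀.2] with y hy
  simp [retractAt_of_mem x₀ hy]

theorem mdifferentiableAt_subtypeVal (x : U) : MDifferentiableAt I I (Subtype.val : U → M) x :=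
  (contMDiff_subtype_val (n := ∞)).mdifferentiableAt (by simp)

/-- Near `x` the retraction is a right inverse of the inclusion, and it is differentiable at `x`.
Hence contact conditions on `M` at points of `U` can be tested on vectors tangent to `U`. -/
theorem mfderiv_subtypeVal_surjective (x : U) (w : TangentSpace I (x : M)) :
    ∃ v : TangentSpace I x, mfderiv I I (Subtype.val : U → M) x v = w := by
  have hx : U.retractAt x (x : M) = x := retractAt_of_mem x x.2
  have h1 : HasMFDerivAt I I (U.retractAt x) (x : M) (mfderiv I I (U.retractAt x) (x : M)) :=
    ((contMDiffAt_retractAt (I := I) x).mdifferentiableAt (by simp)).hasMFDerivAt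
  have h2 : HasMFDerivAt I I (Subtype.val : U → M) (U.retractAt x (x : M))
      (mfderiv I I (Subtype.val : U → M) x) := by
    rw [hx]
    exact (mdifferentiableAt_subtypeVal x).hasMFDerivAt
  have h3 := h2.comp (x : M) h1
  have h4 : HasMFDerivAt I I (Subtype.val ∘ U.retractAt x) (x : M) (ContinuousLinearMap.id ℝ E) := by
    refine (hasMFDerivAt_id (x : M)).congr_of_eventuallyEq ?_
    filter_upwards [U.isOpen.mem_nhds x.2] with y hy
    simp [retractAt_of_mem x hy]
  exact ⟨_, congrArg (fun L : E →L[ℝ] E => L w) (hasMFDerivAt_unique h3 h4)⟩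

open Classical in
/-- The extension of a self-map of the open set `U` by the identity. -/
def extendById (f : U → U) (x : M) : M := if h : x ∈ U then f ⟨x, h⟩ else x

theorem extendById_of_mem (f : U → U) {x : M} (h : x ∈ U) : extendById f x = f ⟨x, h⟩ := dif_pos h

theorem extendById_coe (f : U → U) (x : U) : extendById f (x : M) = f x := extendById_of_mem f x.2

theorem extendById_of_notMem_image {f : U → U} {K : Set U} (h : ∀ x ∉ K, f x = x) {x : M}
    (hx : x ∉ Subtype.val '' K) : extendById f x = x := by
  by_cases hxU : x ∈ U
  · rw [extendById_of_mem f hxU, h _ fun h' => hx ⟨_, h', rfl⟩]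
  · exact dif_neg hxU

theorem extendById_extendById {f g : U → U} (h : ∀ x, f (g x) = x) (x : M) :
    extendById f (extendById g x) = x := by
  by_cases hx : x ∈ U
  · rw [extendById_of_mem g hx, extendById_coe, h]
  · have h1 : ∀ f : U → U, extendById f x = x := fun f => dif_neg hx
    rw [h1 g, h1 f]

/-- Near points of `U` the extension is `Φ` composed with the local retraction. All other points lie
off the closed image of `K`, where the extension is the identity. -/
theorem contMDiff_extendById [T2Space M] {Φ : P → U → U}
    (hΦ : ContMDiff (I'.prod I) I ∞ (Function.uncurry Φ)) {K : Set U} (hK : IsCompact K)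
    (h : ∀ p, ∀ x ∉ K, Φ p x = x) :
    ContMDiff (I'.prod I) I ∞ (fun y : P × M => extendById (Φ y.1) y.2) := by
  rintro ⟨p, x⟩
  by_cases hx : x ∈ U
  · have h1 : ContMDiffAt (I'.prod I) (I'.prod I) ∞
        (fun y : P × M => (y.1, U.retractAt ⟨x, hx⟩ y.2)) (p, x) :=
      contMDiffAt_fst.prodMk
        (ContMDiffAt.comp (g := U.retractAt ⟨x, hx⟩) (p, x)
          (contMDiffAt_retractAt (I := I) ⟨x, hx⟩) contMDiffAt_snd)
    have h2 := ((contMDiff_subtype_val (n := ∞)).comp hΦ).contMDiffAt.comp (p, x) h1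
    refine h2.congr_of_eventuallyEq ?_
    filter_upwards [continuous_snd.continuousAt.preimage_mem_nhds
      (U.isOpen.mem_nhds (show ((p, x) : P × M).2 ∈ (U : Set M) from hx))] with y hy
    simp [extendById_of_mem _ (show y.2 ∈ U from hy),
      retractAt_of_mem _ (show y.2 ∈ U from hy)]
  · have hcl : IsClosed ((Subtype.val : U → M) '' K) := (hK.image continuous_subtype_val).isClosed
    have hxK : ((p, x) : P × M).2 ∈ ((Subtype.val : U → M) '' K)ᶜ := by
      rintro ⟨y, -, rfl⟩
      exact hx y.2
    refine contMDiffAt_snd.congr_of_eventuallyEq ?_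
    filter_upwards [continuous_snd.continuousAt.preimage_mem_nhds
      (hcl.isOpen_compl.mem_nhds hxK)] with y hy
    exact extendById_of_notMem_image (h y.1) hy

theorem contMDiff_extendById_self [T2Space M] {f : U → U} (hf : ContMDiff I I ∞ f) {K : Set U}
    (hK : IsCompact K) (h : ∀ x ∉ K, f x = x) : ContMDiff I I ∞ (extendById f) :=
  (contMDiff_extendById (I' := 𝓘(ℝ, ℝ)) (Φ := fun _ : ℝ => f) (hf.comp contMDiff_snd) hK
    fun _ => h).comp (contMDiff_const (c := (0 : ℝ)).prodMk contMDiff_id)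

end TopologicalSpace.Opens

open TopologicalSpace TopologicalSpace.Opens

variable {U : Opens M} {α : OneForm I M}

/-- The restricted form along a map into `U` is the form along the map into `M`. -/
theorem OneForm.restrict_mfderiv {f : P → U} {p : P} (hf : MDifferentiableAt I' I f p)
    (v : TangentSpace I' p) :
    α.restrict U (f p) (mfderiv I' I f p v) =
      α (f p) (mfderiv I' I (fun p => (f p : M)) p v) := by
  have h := mfderiv_comp p (mdifferentiableAt_subtypeVal (I := I) (f p)) hf
  exact congrArg (α (f p : M)) (congrArg (fun L => L v) h).symm

theorem OneForm.restrict_mfderiv_of_semiconj {f : U → U} {F : M → M} (hfF : ∀ x : U, F x = f x)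
    {x : U} (hf : MDifferentiableAt I I f x) (hF : MDifferentiableAt I I F x)
    (v : TangentSpace I x) :
    α.restrict U (f x) (mfderiv I I f x v) =
      α (F x) (mfderiv I I F x (mfderiv I I (Subtype.val : U → M) x v)) := by
  refine (restrict_mfderiv hf v).trans (α.congr_apply (hfF x).symm ?_)
  have h := mfderiv_comp x hF (mdifferentiableAt_subtypeVal (I := I) x)
  have h1 : F ∘ Subtype.val = fun x : U => (f x : M) := funext hfF
  rw [h1] at h
  exact congrArg (fun L : E →L[ℝ] E => L v) h

theorem IsContactomorphism.extendById [T2Space M] {f : U → U}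
    (hf : IsContactomorphism (α.restrict U) f) {K : Set U} (hK : IsCompact K)
    (h : ∀ x ∉ K, f x = x) : IsContactomorphism α (extendById f) := by
  have hd := hf.mdifferentiableAt
  obtain ⟨⟨F, rfl⟩, hc⟩ := hf
  have h' : ∀ x ∉ K, F.symm x = x := fun x hx => by
    conv_lhs => rw [← h x hx]
    exact F.symm_apply_apply x
  have hsm := contMDiff_extendById_self F.contMDiff hK h
  refine ⟨⟨⟨⟨Opens.extendById F, Opens.extendById F.symm,
    extendById_extendById F.symm_apply_apply, extendById_extendById F.apply_symm_apply⟩, hsm,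
    contMDiff_extendById_self F.symm.contMDiff hK h'⟩, rfl⟩, fun x w => ?_⟩
  by_cases hx : x ∈ U
  · obtain ⟨v, hv⟩ := mfderiv_subtypeVal_surjective ⟨x, hx⟩ w
    rw [← hv]
    have h1 := OneForm.restrict_mfderiv_of_semiconj (α := α) (extendById_coe F) (hd ⟨x, hx⟩)
      (hsm.mdifferentiableAt (by simp)) v
    rw [← h1]
    exact hc ⟨x, hx⟩ v
  · have hcl : IsClosed ((Subtype.val : U → M) '' K) := (hK.image continuous_subtype_val).isClosed
    have hxK : x ∈ ((Subtype.val : U → M) '' K)ᶜ := by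
      rintro ⟨y, -, rfl⟩
      exact hx y.2
    have h1 : Opens.extendById F =ᶠ[𝓝 x] _root_.id := by
      filter_upwards [hcl.isOpen_compl.mem_nhds hxK] with y hy
      exact extendById_of_notMem_image h hy
    have h2 : (mfderiv I I (Opens.extendById F) x : E →L[ℝ] E) = ContinuousLinearMap.id ℝ E :=
      h1.mfderiv_eq.trans mfderiv_id
    exact iff_of_eq (congrArg (· = 0)
      (α.congr_apply h1.self_of_nhds (congrArg (fun L : E →L[ℝ] E => L w) h2)))

/-- An isotopy of `U` extends to a family on `M`. -/
theorem IsContactIsotopy.exists_family [T2Space M] {φ : ℝ → U → U}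
    (hφ : IsContactIsotopy (α.restrict U) φ) :
    ∃ ψ, IsContactFamily α U ψ ∧ (∀ x, ψ 0 x = x) ∧ ψ 1 = extendById (φ 1) := by
  obtain ⟨K, hK, hfix⟩ := hφ.compactSupport
  -- The isotopy is controlled only for times in `[0,1]`. The smooth step takes values there and
  -- fixes both ends, so it yields a family over `ℝ` with the same end.
  have hmem : ∀ t, Real.smoothTransition t ∈ Icc (0 : ℝ) 1 := fun t =>
    ⟨Real.smoothTransition.nonneg t, Real.smoothTransition.le_one t⟩
  have hsm : ContMDiff (𝓘(ℝ, ℝ).prod I) I ∞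
      (Function.uncurry fun t (x : U) => φ (Real.smoothTransition t) x) :=
    hφ.smooth.comp_contMDiff
      (f := fun y : ℝ × U => (Real.smoothTransition y.1, y.2))
      ((Real.smoothTransition.contDiff.contMDiff.comp contMDiff_fst).prodMk contMDiff_snd)
      fun y => ⟨hmem y.1, mem_univ _⟩
  refine ⟨fun t => extendById (φ (Real.smoothTransition t)), ⟨contMDiff_extendById hsm hK
    fun t => hfix _ (hmem t), fun t => (hφ.contact _ (hmem t)).extendById hK (hfix _ (hmem t)),
    Subtype.val '' K, ?_, hK.image continuous_subtype_val,
    fun t x hx => extendById_of_notMem_image (hfix _ (hmem t)) hx⟩, fun x => ?_, ?_⟩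
  · rintro _ ⟨x, -, rfl⟩
    exact x.2
  · simp only [Real.smoothTransition.zero, hφ.zero]
    exact extendById_of_notMem_image (K := ∅) (fun _ _ => rfl) (by simp)
  · simp only [Real.smoothTransition.one]

/-- Each map of the reaching family is injective and is the identity off a compact subset of `U`, so
it preserves `U`; the restricted family is an isotopy of `U` with the same Hamiltonian. -/
theorem IsReachable.contactEnergy_restrict_le {e : ℝ≥0∞} {F : M → M} (hF : IsReachable α U e F)
    {f : U → U} (hfF : ∀ x : U, F x = f x) : contactEnergy (α.restrict U) f ≤ e := by
  obtain ⟨ψ, hψ, h0, h1, b, -, hbH, hbe⟩ := hF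
  obtain ⟨K, hKU, hK, hfix⟩ := hψ.compactSupport
  have hmaps : ∀ G : M → M, Function.Injective G → (∀ x ∉ K, G x = x) → ∀ x ∈ U, G x ∈ U := by
    intro G hG hGK x hx
    by_contra hGx
    have h2 : G (G x) = G x := hGK _ fun h => hGx (hKU h)
    rw [hG h2] at hGx
    exact hGx hx
  have hinj : ∀ t, Function.Injective (ψ t) := fun t => by
    obtain ⟨⟨G, hG⟩, -⟩ := hψ.contact t
    rw [← hG]
    exact G.injective
  have hU := fun t => hmaps (ψ t) (hinj t) (hfix t)
  set θ : ℝ → U → U := fun t x => ⟨ψ t x, hU t x x.2⟩ with hθ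
  have hsm : ContMDiff (𝓘(ℝ, ℝ).prod I) I ∞ (Function.uncurry θ) := by
    rw [← ContMDiff.subtypeVal_comp_iff]
    exact hψ.smooth.comp (contMDiff_fst.prodMk (contMDiff_subtype_val.comp contMDiff_snd))
  have hsm' : ∀ t, ContMDiff I I ∞ (θ t) := fun t => hsm.comp (contMDiff_const.prodMk contMDiff_id)
  have hiso : IsContactIsotopy (α.restrict U) θ := by
    refine ⟨funext fun x => Subtype.ext (h0 0 le_rfl x), hsm.contMDiffOn, fun t _ => ⟨?_, ?_⟩,
      Subtype.val ⁻¹' K, ?_, fun t _ x hx => Subtype.ext (hfix t x hx)⟩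
    · obtain ⟨⟨G, hG⟩, -⟩ := hψ.contact t
      have hGK : ∀ x ∉ K, G.symm x = x := fun x hx => by
        conv_lhs => rw [← hfix t x hx, ← hG]
        exact G.symm_apply_apply x
      have hGU := hmaps _ G.symm.injective hGK
      refine ⟨⟨⟨θ t, fun x => ⟨G.symm x, hGU x x.2⟩, fun x => Subtype.ext ?_,
        fun x => Subtype.ext ?_⟩, hsm' t, ?_⟩, rfl⟩
      · change G.symm (ψ t x) = x
        rw [← hG]
        exact G.symm_apply_apply _
      · change ψ t (G.symm x) = x
        rw [← hG]
        exact G.apply_symm_apply _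
      · rw [← ContMDiff.subtypeVal_comp_iff]
        exact G.symm.contMDiff.comp contMDiff_subtype_val
    · intro x v
      have h2 := OneForm.restrict_mfderiv_of_semiconj (α := α) (f := θ t) (F := ψ t) (fun _ => rfl)
        ((hsm' t).mdifferentiableAt (by simp) (x := x)) ((hψ.contact t).mdifferentiableAt x) v
      rw [h2]
      exact (hψ.contact t).2 x _
    · rw [Subtype.isCompact_iff]
      rwa [image_preimage_eq_of_subset]
      rwa [Subtype.range_coe_subtype]
  have hend : θ 1 = f := funext fun x => Subtype.ext <| by
    rw [← hfF, ← h1 1 le_rfl]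
  refine (iInf₂_le_of_le θ hiso (iInf_le_of_le hend le_rfl)).trans ?_
  refine le_trans ?_ ((MeasureTheory.setLIntegral_le_lintegral (Icc 0 1) b).trans hbe)
  refine MeasureTheory.setLIntegral_mono' measurableSet_Icc fun t ht => iSup_le fun x => ?_
  refine le_trans (le_of_eq ?_) (hbH t x)
  have hpath : MDifferentiableAt 𝓘(ℝ, ℝ) I (fun s => θ s x) t :=
    (hsm.comp (contMDiff_id.prodMk contMDiff_const)).mdifferentiableAt (by simp)
  have h3 : (mfderivWithin 𝓘(ℝ, ℝ) I (fun s => θ s x) (Icc 0 1) t : ℝ →L[ℝ] E) =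
      mfderiv 𝓘(ℝ, ℝ) I (fun s => θ s x) t :=
    mfderivWithin_eq_mfderiv ((uniqueDiffOn_Icc zero_lt_one).uniqueMDiffOn t ht) hpath
  have h4 : contactHamiltonian (α.restrict U) θ t x = familyHamiltonian α ψ t x :=
    (congrArg (α.restrict U (θ t x)) (congrArg (fun L : ℝ →L[ℝ] E => L 1) h3)).trans
      (OneForm.restrict_mfderiv hpath (1 : ℝ))
  rw [h4]

end OpenSubmanifold

/-! ## Rescaling towards the zero section and the energy estimate -/

section Weinstein

variable {n : ℕ} {N : Type*} [TopologicalSpace N] [ChartedSpace (EuclideanSpace ℝ (Fin n)) N]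
  [IsManifold (𝓡 n) ∞ N]

theorem IsLocalWeinsteinNeighborhood.abs_snd_lt {δ : ℝ} {U : TopologicalSpace.Opens (JetBundle n N)}
    (hU : IsLocalWeinsteinNeighborhood δ U) {x : JetBundle n N}
    (hx : x ∈ U) : |x.2| < δ := by
  obtain ⟨V, W, d, -, -, hd, hUe⟩ := hU
  rw [← SetLike.mem_coe, hUe] at hx
  exact hx.2.2.trans_le (hd _ hx.1).2

theorem IsLocalWeinsteinNeighborhood.jetScale_mem {δ : ℝ}
    {U : TopologicalSpace.Opens (JetBundle n N)}
    (hU : IsLocalWeinsteinNeighborhood δ U) {l : ℝ} (hl : 0 ≤ l) (hl' : l ≤ 1) {x : JetBundle n N}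
    (hx : x ∈ U) : jetScale l x ∈ U := by
  obtain ⟨V, W, d, -, hW, -, hUe⟩ := hU
  rw [← SetLike.mem_coe, hUe] at hx ⊢
  refine ⟨hx.1, (hW _ hx.1).2.smul_mem hx.2.1 hl hl', ?_⟩
  change |l * x.2| < d x.1.proj
  rw [abs_mul, abs_of_nonneg hl]
  exact (mul_le_of_le_one_left (abs_nonneg _) hl').trans_lt hx.2.2

/-- If a rescaling on `K` by `l` is reached with energy `e`, then conjugating by rescalings reaches
the rescaling on `K` by `l ^ m` with energy `∑ k < m, l ^ k * e`. -/
theorem IsReachable.exists_jetScale_pow {U K : Set (JetBundle n N)}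
    {f : JetBundle n N → JetBundle n N} {l c : ℝ} (hl : 0 < l) (hl' : l ≤ 1) (hc : 0 ≤ c)
    (hf : IsReachable (stdContactForm n N) U (ENNReal.ofReal c) f)
    (hfK : ∀ x ∈ K, f x = jetScale l x)
    (hU : ∀ l, 0 < l → l ≤ 1 → ∀ x ∈ U, jetScale l x ∈ U) (m : ℕ) :
    ∃ g, IsReachable (stdContactForm n N) U (ENNReal.ofReal (c * ∑ k ∈ Finset.range m, l ^ k)) g ∧
      ∀ x ∈ K, g x = jetScale (l ^ m) x := by
  induction m with
  | zero =>
    exact ⟨fun x => x, by simpa using IsReachable.id (stdContactForm n N) U, fun x _ => by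
      rw [pow_zero, jetScale_one]⟩
  | succ m ih =>
    obtain ⟨g, hg, hgK⟩ := ih
    have hm : 0 < l ^ m := pow_pos hl m
    -- After `g` has moved `K` to its rescaling by `l ^ m`, the conjugate of `f` by that rescaling
    -- acts on the image as rescaling by `l`, at the cost of `l ^ m * c`.
    refine ⟨_, ((hf.jetScale_conj hm (hU _ hm (pow_le_one₀ hl.le hl'))).comp hg).mono (le_of_eq ?_),
      fun x hx => ?_⟩
    · rw [← ENNReal.ofReal_mul hm.le, ← ENNReal.ofReal_add (by positivity) (by positivity),
        Finset.sum_range_succ]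
      ring_nf
    · simp only [hgK x hx, jetScale_jetScale, inv_mul_cancel₀ hm.ne', jetScale_one, hfK x hx,
        pow_succ]

/-- The sum is at most 1 / (1 - e^{-σ}), and e^{-σ}(1 + σ) ≤ 1 gives σ ≤ (1 + σ)(1 - e^{-σ}). -/
theorem mul_geom_sum_exp_neg_le {σ : ℝ} (hσ : 0 < σ) (m : ℕ) :
    σ * ∑ k ∈ Finset.range m, Real.exp (-σ) ^ k ≤ 1 + σ := by
  have h0 := Real.exp_pos (-σ)
  have h1 : Real.exp (-σ) * (1 + σ) ≤ 1 := by
    have h2 : Real.exp (-σ) * Real.exp σ = 1 := by rw [← Real.exp_add]; simp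
    have h3 := mul_le_mul_of_nonneg_left (Real.add_one_le_exp σ) h0.le
    linarith
  have h3 := mul_neg_geom_sum (Real.exp (-σ)) m
  have h4 : 0 ≤ ∑ k ∈ Finset.range m, Real.exp (-σ) ^ k :=
    Finset.sum_nonneg fun k _ => (pow_pos h0 k).le
  nlinarith [pow_pos h0 m, mul_nonneg h4 (sub_nonneg.2 h1)]

omit [IsManifold (𝓡 n) ∞ N] in
/-- If `g` is supported in `K` and `f` is on `K` the rescaling by `l`, then `g` is the conjugate by
`f` of its rescaled version. -/
theorem eq_inverse_comp_jetScale_conj {K : Set (JetBundle n N)}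
    {f f' g : JetBundle n N → JetBundle n N} {l : ℝ} (hl : l ≠ 0)
    (hf : ∀ x, f' (f x) = x) (hfK : ∀ x ∈ K, f x = jetScale l x) (hg : Function.Injective g)
    (hgK : ∀ x ∉ K, g x = x) (x : JetBundle n N) :
    f' (jetScale l (g (jetScale l⁻¹ (f x)))) = g x := by
  by_cases hx : x ∈ K
  · have hgx : g x ∈ K := by
      by_contra h
      rw [hg (hgK _ h)] at h
      exact h hx
    rw [hfK x hx, jetScale_jetScale, inv_mul_cancel₀ hl, jetScale_one, ← hfK _ hgx, hf]
  · have h1 : jetScale l⁻¹ (f x) ∉ K := fun h => by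
      have h2 := hfK _ h
      rw [jetScale_jetScale, mul_inv_cancel₀ hl, jetScale_one] at h2
      have h3 := congrArg f' h2
      rw [hf, hf] at h3
      exact hx (h3 ▸ h)
    rw [hgK _ h1, jetScale_jetScale, mul_inv_cancel₀ hl, jetScale_one, hf, hgK x hx]

end Weinstein

end

theorem mainTheorem9 {n : ℕ} {N : Type*} [TopologicalSpace N] [T2Space N]
    [SecondCountableTopology N] [ChartedSpace (EuclideanSpace ℝ (Fin n)) N]
    [IsManifold (𝓡 n) ∞ N] (δ : ℝ) (hδ : 0 < δ)
    (U : TopologicalSpace.Opens (JetBundle n N)) (hU : IsLocalWeinsteinNeighborhood δ U)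
    (φ : ℝ → U → U) (hφ : IsContactIsotopy ((stdContactForm n N).restrict U) φ) :
    contactEnergy ((stdContactForm n N).restrict U) (φ 1) < ENNReal.ofReal (2 * δ) := by
  obtain ⟨Φ, hΦ, hΦ0, hΦ1⟩ := hφ.exists_family
  set g := TopologicalSpace.Opens.extendById (φ 1)
  obtain ⟨K, hKU, hK, hfix⟩ := hΦ.compactSupport
  have hgK : ∀ x ∉ K, g x = x := fun x hx => by rw [← hΦ1]; exact hfix 1 x hx
  obtain ⟨B, hB, hΦB⟩ := hΦ.exists_bound
  have hg : IsReachable (stdContactForm n N) U (ENNReal.ofReal B) g := by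
    rw [← hΦ1, ← one_mul B]
    exact hΦ.isReachable hΦ0 zero_le_one hB hΦB
  have hginj : Function.Injective g := by
    obtain ⟨⟨G, hG⟩, -⟩ := hg.contact
    rw [← hG]
    exact G.injective
  have hscale : ∀ l : ℝ, 0 < l → l ≤ 1 → ∀ x ∈ (U : Set (JetBundle n N)),
      jetScale l x ∈ (U : Set (JetBundle n N)) := fun l h h' x hx => hU.jetScale_mem h.le h' hx
  obtain ⟨χ, ψ, hψ, hχ1, hχK⟩ := exists_isSqueeze U.isOpen hK hKU
  obtain ⟨D, hD, hDδ, hψD⟩ := hψ.family.exists_hamiltonian_bound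
    (fun x => (hψ.hamiltonian x).trans (mul_le_of_le_one_left (abs_nonneg _) (hχ1 _))) hδ
    fun x hx => hU.abs_snd_lt hx
  obtain ⟨ε, hε, hεψ⟩ := Metric.eventually_nhds_iff.1
    (hψD.and (hψ.eventually_eq_jetScale hK hχK))
  -- The strict inequality `D < δ` absorbs the factor `1 + σ` lost in the geometric sum.
  obtain ⟨σ, hσ, hσε, hσD⟩ : ∃ σ, 0 < σ ∧ σ < ε ∧ (1 + σ) * D < δ := by
    have h1 : Filter.Tendsto (fun σ : ℝ => (1 + σ) * D) (𝓝[>] 0) (𝓝 ((1 + 0) * D)) :=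
      (Continuous.tendsto (by fun_prop) 0).mono_left nhdsWithin_le_nhds
    have h2 := h1.eventually_lt_const (u := δ) (by linarith)
    have h3 : ∀ᶠ σ : ℝ in 𝓝[>] 0, σ < ε := (eventually_lt_nhds hε).filter_mono nhdsWithin_le_nhds
    obtain ⟨σ, hσ⟩ := (h2.and (h3.and self_mem_nhdsWithin)).exists
    exact ⟨σ, hσ.2.2, hσ.2.1, hσ.1⟩
  have hdist : ∀ t ∈ Icc 0 σ, dist t 0 < ε := fun t ht => by
    rw [Real.dist_0_eq_abs, abs_of_nonneg ht.1]
    exact ht.2.trans_lt hσε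
  have hf₀ : IsReachable (stdContactForm n N) U (ENNReal.ofReal (σ * D)) (ψ σ) :=
    hψ.family.isReachable hψ.zero hσ.le hD fun t ht => (hεψ (hdist t ht)).1
  have hl0 := Real.exp_pos (-σ)
  have hl1 : Real.exp (-σ) < 1 := Real.exp_zero ▸ Real.exp_lt_exp.2 (by linarith)
  -- The rescaled copy of `g` will cost e^{-mσ} B, and this must fit into the gap between the cost
  -- 2(1 + σ)D of `f` and its inverse and 2δ.
  obtain ⟨m, hm⟩ : ∃ m : ℕ, Real.exp (-σ) ^ m * B < 2 * δ - 2 * ((1 + σ) * D) := by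
    have h1 := (tendsto_pow_atTop_nhds_zero_of_lt_one hl0.le hl1).mul_const B
    rw [zero_mul] at h1
    exact (h1.eventually_lt_const (by linarith)).exists
  obtain ⟨f, hf, hfK⟩ := hf₀.exists_jetScale_pow hl0 hl1.le (mul_nonneg hσ.le hD)
    (hεψ (hdist σ ⟨hσ.le, le_rfl⟩)).2 hscale m
  have hlm : 0 < Real.exp (-σ) ^ m := pow_pos hl0 m
  replace hf : IsReachable (stdContactForm n N) U (ENNReal.ofReal ((1 + σ) * D)) f := by
    refine hf.mono (ENNReal.ofReal_le_ofReal ?_)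
    have h := mul_le_mul_of_nonneg_right (mul_geom_sum_exp_neg_le hσ m) hD
    linarith
  obtain ⟨f', hf'f, hff'⟩ : ∃ f' : JetBundle n N → JetBundle n N,
      (∀ x, f' (f x) = x) ∧ ∀ x, f (f' x) = x := by
    obtain ⟨⟨G, hG⟩, -⟩ := hf.contact
    rw [← hG]
    exact ⟨G.symm, G.symm_apply_apply, G.apply_symm_apply⟩
  have hgm := hg.jetScale_conj hlm (hscale _ hlm (pow_le_one₀ hl0.le hl1.le))
  have htotal := (hf.inverse hf'f hff').comp (hgm.comp hf)
  refine (htotal.contactEnergy_restrict_le fun x => ?_).trans_lt ?_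
  · rw [eq_inverse_comp_jetScale_conj hlm.ne' hf'f hfK hginj hgK]
    exact TopologicalSpace.Opens.extendById_coe _ x
  · have h0 : 0 ≤ (1 + σ) * D := by positivity
    rw [← ENNReal.ofReal_mul hlm.le, ← ENNReal.ofReal_add (by positivity) h0,
      ← ENNReal.ofReal_add h0 (by positivity)]
    exact (ENNReal.ofReal_lt_ofReal_iff (by linarith)).2 (by linarith)
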